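/- **Model.** A cell-free system has $L$ access points (APs) with $M$ antennas each, $K\ge 1$ single-antenna users and a single-antenna eavesdropper $E$ attacking user $1$. The channels are $\mathbf h_{l,k}=\sqrt{\beta_{l,k}}\,\mathbf g_{l,k}$ and $\mathbf h_{l,E}=\sqrt{\beta_{l,E}}\,\mathbf g_{l,E}$ with $\beta_{l,k}>0$, $\beta_{l,E}\ge 0$. AP $l$ receives the pilot matrix $$\mathbf Y_l=\sqrt{\tau_p\rho_u}\sum_{k=1}^K\mathbf h_{l,k}\boldsymbol\phi_k^{\mathrm H}+\sqrt{\tau_p\rho_E}\,\mathbf h_{l,E}\boldsymbol\phi_1^{\mathrm H}+\mathbf N_l ,$$ where $\boldsymbol\phi_1,\dots,\boldsymbol\phi_K\in\mathbb C^{\tau_p}$ are orthonormal, $\rho_u>0$, $\rho_E\ge 0$, and all entries of all $\mathbf g_{l,k},\mathbf g_{l,E},\mathbf N_l$ are i.i.d. $\mathcal{CN}(0,1)$. Put $v_{l,k}=\tau_p\rho_u\beta_{l,k}+1$ for $k\ne 1$ and $v_{l,1}=\tau_p\rho_u\beta_{l,1}+\tau_p\rho_E\beta_{l,E}+1$. The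 channel estimates are $\hat{\mathbf h}_{l,k}=\frac{\sqrt{\tau_p\rho_u}\,\beta_{l,k}}{v_{l,k}}\mathbf Y_l\boldsymbol\phi_k$; put $\gamma_{l,k}=\tau_p\rho_u\beta_{l,k}^2/v_{l,k}$ and $\gamma_{l,E}=\frac{\rho_E\beta_{l,E}^2}{\rho_u\beta_{l,1}^2}\gamma_{l,1}$. Each AP $l$ has a fixed set $\mathcal S_l\subseteq\{1,\dots,K\}$ of strong users with $|\mathcal S_l|<M$. Let $\hat{\mathbf H}_{\mathcal S_l}$ be the matrix with columns $\hat{\mathbf h}_{l,i}$, $i\in\mathcal S_l$. The protective partial zero-forcing (PPZF) precoder is $\mathbf w_{l,k}=\mathbf v_{l,k}/\sqrt{\mathbb E\|\mathbf v_{l,k}\|^2}$, where for $k\in\mathcal S_l$ the vector $\mathbf v_{l,k}$ is the column of $\hat{\mathbf H}_{\mathcal S_l}(\hat{\mathbf H}_{\mathcal S_l}^{\mathrm H}\hat{\mathbf H}_{\mathcal S_l})^{-1}$ belonging to $k$, and for $k\notin\mathcal S_l$, $\mathbf v_{l,k}=\big(\mathbf I_M-\hat{\mathbf H}_{\mathcal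 S_l}(\hat{\mathbf H}_{\mathcal S_l}^{\mathrm H}\hat{\mathbf H}_{\mathcal S_l})^{-1}\hat{\mathbf H}_{\mathcal S_l}^{\mathrm H}\big)\hat{\mathbf h}_{l,k}$. AP $l$ transmits $\mathbf x_l=\sum_k\sqrt{\rho_{l,k}}\,\mathbf w_{l,k}s_k$ with $\rho_{l,k}\ge 0$, and the eavesdropper receives $z_E=\sum_l\mathbf h_{l,E}^{\mathrm H}\mathbf x_l+n_E$ with noise of unit power. Put $\mathrm{BU}_{E,1}=\sum_l\sqrt{\rho_{l,1}}\,\mathbf h_{l,E}^{\mathrm H}\mathbf w_{l,1}$ and $\mathrm{UI}_{E,t}=\sum_l\sqrt{\rho_{l,t}}\,\mathbf h_{l,E}^{\mathrm H}\mathbf w_{l,t}$ for $t\ne 1$. Let $X=|\mathrm{BU}_{E,1}|^2$ and $Y=\sum_{t\ne1}|\mathrm{UI}_{E,t}|^2+1$. The spectral efficiency (SE) of the eavesdropper with perfect channel knowledge is $R_E=\mathbb E\{\log_2(1+X/Y)\}$. Put $\mathcal Z_1=\{l:1\in\mathcal S_l\}$, and $\delta_{l,1}=1$ if $1\in\mathcal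 S_l$, $\delta_{l,1}=0$ otherwise. **Proposition 2.** One has $z_E=\mathrm{BU}_{E,1}s_1+\sum_{t\neq1}\mathrm{UI}_{E,t}s_t+n_E$. The variables $|\mathrm{BU}_{E,1}|^2$ and $|\mathrm{UI}_{E,t}|^2$ are integrable, with $$\mathbb E|\mathrm{BU}_{E,1}|^2=\Big(\sum_{l}\sqrt{\rho_{l,1}(M-|\mathcal S_l|)\gamma_{l,E}}\Big)^2+\sum_l\rho_{l,1}\beta_{l,E}-\sum_{l\in\mathcal Z_1}\rho_{l,1}\gamma_{l,E},$$ $$\mathbb E|\mathrm{UI}_{E,t}|^2=\sum_l\rho_{l,t}(\beta_{l,E}-\delta_{l,1}\gamma_{l,E})\qquad(t\ne1).$$ Consequently the approximation of $R_E$ obtained by replacing $X$ and $Y$ by their means is $$\log_2\Big(1+\frac{\mathbb E|\mathrm{BU}_{E,1}|^2}{\sum_{t\ne1}\mathbb E|\mathrm{UI}_{E,t}|^2+1}\Big)=\log_2(1+\mathrm{SINR}_E),$$ $$\mathrm{SINR}_E=\frac{\big(\sum_{l}\sqrt{\rho_{l,1}(M-|\mathcal S_l|)\gamma_{l,E}}\big)^2+\sum_l\rho_{l,1}\beta_{l,E}-\sum_{l\in\mathcal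 Z_1}\rho_{l,1}\gamma_{l,E}}{\sum_{t\ne1}\sum_l\rho_{l,t}(\beta_{l,E}-\delta_{l,1}\gamma_{l,E})+1}.$$ Moreover $\log_2(1+X/Y)$ is integrable, and $R_E\approx\log_2(1+\mathrm{SINR}_E)$ in the sense that $$\big|R_E-\log_2(1+\mathrm{SINR}_E)\big|\le\frac{1}{\ln 2}\max\{D(X+Y),D(Y)\},\qquad D(Z)=\mathbb E\Big\{\frac{(Z-\mathbb E Z)^2}{Z\,\mathbb E Z}\Big\}.$$ -/

import Mathlib

open MeasureTheory ProbabilityTheory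

noncomputable section

namespace CellFree

/-- The circularly symmetric complex Gaussian law `CN(0, v)`: real and imaginary parts are
independent centred real Gaussians of variance `v / 2`. -/
def complexGaussian (v : NNReal) : Measure ℂ :=
  ((gaussianReal 0 (v / 2)).prod (gaussianReal 0 (v / 2))).map
    (fun p : ℝ × ℝ => (⟨p.1, p.2⟩ : ℂ))

/-- Squared Euclidean norm of a complex vector. -/
def sqNorm {M : ℕ} (v : Fin M → ℂ) : ℝ := ∑ m, ‖v m‖ ^ 2

/-- Deterministic parameters of the system: `L` access points (APs) with `M` antennas each,
`K` single-antenna users, and pilots of length `τ`. User `0 : Fin K` is the attacked user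
(user 1 in the usual numbering). -/
structure Params (L K M τ : ℕ) where
  /-- large-scale fading between an AP and a user -/
  β : Fin L → Fin K → ℝ
  /-- large-scale fading between an AP and the eavesdropper -/
  βE : Fin L → ℝ
  /-- uplink pilot SNR of the users -/
  ρu : ℝ
  /-- uplink pilot SNR of the eavesdropper -/
  ρE : ℝ
  /-- downlink power control coefficients -/
  ρ : Fin L → Fin K → ℝ
  /-- pilot sequences -/
  φ : Fin K → Fin τ → ℂ
  /-- strong users of an AP; the weak users are the remaining ones -/
  S : Fin L → Finset (Fin K)

/-- Standing assumptions on the parameters: positive fading and pilot SNR, nonnegative powers,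
orthonormal pilots, and more antennas than strong users at every AP. -/
structure Params.Admissible {L K M τ : ℕ} (p : Params L K M τ) : Prop where
  β_pos : ∀ l k, 0 < p.β l k
  βE_nonneg : ∀ l, 0 ≤ p.βE l
  ρu_pos : 0 < p.ρu
  ρE_nonneg : 0 ≤ p.ρE
  ρ_nonneg : ∀ l k, 0 ≤ p.ρ l k
  pilots : ∀ k k', star (p.φ k) ⬝ᵥ p.φ k' = if k = k' then 1 else 0
  card_lt : ∀ l, (p.S l).card < M

/-- The random quantities: small-scale fading to the users, small-scale fading to the
eavesdropper, and the noise received by each AP during uplink training. -/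
structure Randomness (Ω : Type*) (L K M τ : ℕ) where
  g : Fin L → Fin K → Fin M → Ω → ℂ
  gE : Fin L → Fin M → Ω → ℂ
  N : Fin L → Fin M → Fin τ → Ω → ℂ

/-- All scalar random entries, as one family. -/
def Randomness.entries {Ω : Type*} {L K M τ : ℕ} (r : Randomness Ω L K M τ) :
    (Fin L × Fin K × Fin M) ⊕ (Fin L × Fin M) ⊕ (Fin L × Fin M × Fin τ) → Ω → ℂ :=
  Sum.elim (fun i => r.g i.1 i.2.1 i.2.2)
    (Sum.elim (fun i => r.gE i.1 i.2) (fun i => r.N i.1 i.2.1 i.2.2))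

/-- Independent Rayleigh fading and noise: all entries are i.i.d. `CN(0, 1)`. -/
structure Randomness.IsRayleigh {Ω : Type*} [MeasurableSpace Ω] {L K M τ : ℕ}
    (r : Randomness Ω L K M τ) (P : Measure Ω) : Prop where
  indep : iIndepFun r.entries P
  law : ∀ i, HasLaw (r.entries i) (complexGaussian 1) P

section Model

variable {Ω : Type*} {L K M τ : ℕ}

/-- Channel from AP `l` to user `k`. -/
def h (p : Params L K M τ) (r : Randomness Ω L K M τ) (l : Fin L) (k : Fin K) (ω : Ω) :
    Fin M → ℂ :=
  fun m => (Real.sqrt (p.β l k) : ℂ) * r.g l k m ω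

/-- Channel from AP `l` to the eavesdropper. -/
def hE (p : Params L K M τ) (r : Randomness Ω L K M τ) (l : Fin L) (ω : Ω) : Fin M → ℂ :=
  fun m => (Real.sqrt (p.βE l) : ℂ) * r.gE l m ω

/-- Received pilot matrix at AP `l`; the eavesdropper sends the pilot of user `0`. -/
def pilotMatrix [NeZero K] (p : Params L K M τ) (r : Randomness Ω L K M τ) (l : Fin L) (ω : Ω) :
    Matrix (Fin M) (Fin τ) ℂ :=
  (Real.sqrt (τ * p.ρu) : ℂ) • ∑ k, Matrix.vecMulVec (h p r l k ω) (star (p.φ k))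
    + (Real.sqrt (τ * p.ρE) : ℂ) • Matrix.vecMulVec (hE p r l ω) (star (p.φ 0))
    + Matrix.of fun m j => r.N l m j ω

/-- The variance `τ ρu β + 1` (plus `τ ρE βE` for the attacked user) of the entries of the
projected pilot signal. -/
def pilotVar [NeZero K] (p : Params L K M τ) (l : Fin L) (k : Fin K) : ℝ :=
  if k = 0 then τ * p.ρu * p.β l k + τ * p.ρE * p.βE l + 1 else τ * p.ρu * p.β l k + 1

/-- The MMSE channel estimate of `h l k`, computed from the projected pilot signal. -/
def hhat [NeZero K] (p : Params L K M τ) (r : Randomness Ω L K M τ) (l : Fin L) (k : Fin K)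
    (ω : Ω) : Fin M → ℂ :=
  ((Real.sqrt (τ * p.ρu) * p.β l k / pilotVar p l k : ℝ) : ℂ) •
    (pilotMatrix p r l ω).mulVec (p.φ k)

/-- Variance of the channel estimate to user `k`. -/
def γ [NeZero K] (p : Params L K M τ) (l : Fin L) (k : Fin K) : ℝ :=
  τ * p.ρu * p.β l k ^ 2 / pilotVar p l k

/-- `γ_{l,E} = α_{l,1} γ_{l,1}` with `α_{l,1} = ρE βE² / (ρu β_{l,1}²)`. -/
def γE [NeZero K] (p : Params L K M τ) (l : Fin L) : ℝ :=
  p.ρE * p.βE l ^ 2 / (p.ρu * p.β l 0 ^ 2) * γ p l 0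

/-- The collective channel estimate `Ĥ_l`, an `M × K` matrix. -/
def Hhat [NeZero K] (p : Params L K M τ) (r : Randomness Ω L K M τ) (l : Fin L) (ω : Ω) :
    Matrix (Fin M) (Fin K) ℂ :=
  Matrix.of fun m k => hhat p r l k ω m

/-- The selection matrix of the columns of the strong users of AP `l`. -/
def selS (p : Params L K M τ) (l : Fin L) : Matrix (Fin K) (p.S l) ℂ :=
  Matrix.of fun k i => if k = i then 1 else 0

/-- `Ĥ_l E_S`: the estimates of the strong users of AP `l`. -/
def HS [NeZero K] (p : Params L K M τ) (r : Randomness Ω L K M τ) (l : Fin L) (ω : Ω) :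
    Matrix (Fin M) (p.S l) ℂ :=
  Hhat p r l ω * selS p l

/-- `Ĥ_l E_S (E_Sᴴ Ĥ_lᴴ Ĥ_l E_S)⁻¹`. -/
def pinvS [NeZero K] (p : Params L K M τ) (r : Randomness Ω L K M τ) (l : Fin L) (ω : Ω) :
    Matrix (Fin M) (p.S l) ℂ :=
  HS p r l ω * ((HS p r l ω).conjTranspose * HS p r l ω)⁻¹

/-- Unnormalized partial zero-forcing vector; only used for `k ∈ S l`. -/
def vPZF [NeZero K] (p : Params L K M τ) (r : Randomness Ω L K M τ) (l : Fin L) (k : Fin K)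
    (ω : Ω) : Fin M → ℂ :=
  (pinvS p r l ω).mulVec fun i => if (i : Fin K) = k then 1 else 0

/-- The projection `B_l` onto the orthogonal complement of the strong users' estimates. -/
def projB [NeZero K] (p : Params L K M τ) (r : Randomness Ω L K M τ) (l : Fin L) (ω : Ω) :
    Matrix (Fin M) (Fin M) ℂ :=
  1 - pinvS p r l ω * (HS p r l ω).conjTranspose

/-- Unnormalized protective maximum-ratio vector; only used for `k ∉ S l`. -/
def vPMRT [NeZero K] (p : Params L K M τ) (r : Randomness Ω L K M τ) (l : Fin L) (k : Fin K)
    (ω : Ω) : Fin M → ℂ :=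
  (projB p r l ω).mulVec (hhat p r l k ω)

/-- A random vector divided by the root of its mean squared norm. -/
def normalize [MeasurableSpace Ω] (P : Measure Ω) (v : Ω → Fin M → ℂ) (ω : Ω) : Fin M → ℂ :=
  (((Real.sqrt (∫ ω', sqNorm (v ω') ∂P))⁻¹ : ℝ) : ℂ) • v ω

/-- The protective partial zero-forcing precoder of AP `l` towards user `k`. -/
def w [NeZero K] [MeasurableSpace Ω] (P : Measure Ω) (p : Params L K M τ)
    (r : Randomness Ω L K M τ) (l : Fin L) (k : Fin K) : Ω → Fin M → ℂ :=
  if k ∈ p.S l then normalize P (vPZF p r l k) else normalize P (vPMRT p r l k)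

/-- Signal transmitted by AP `l` when the data symbols are `s`. -/
def transmit [NeZero K] [MeasurableSpace Ω] (P : Measure Ω) (p : Params L K M τ)
    (r : Randomness Ω L K M τ) (s : Fin K → ℂ) (l : Fin L) (ω : Ω) : Fin M → ℂ :=
  ∑ k, ((Real.sqrt (p.ρ l k) : ℂ) * s k) • w P p r l k ω

/-- Signal received by the eavesdropper for data symbols `s` and noise value `n`. -/
def zE [NeZero K] [MeasurableSpace Ω] (P : Measure Ω) (p : Params L K M τ)
    (r : Randomness Ω L K M τ) (s : Fin K → ℂ) (n : ℂ) (ω : Ω) : ℂ :=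
  ∑ l, star (hE p r l ω) ⬝ᵥ transmit P p r s l ω + n

/-- Effective channel at the eavesdropper of the symbol of user `t`: the desired gain
`BU_{E,1}` for the attacked user, and the interference gain `UI_{E,t}` for the others. -/
def gainE [NeZero K] [MeasurableSpace Ω] (P : Measure Ω) (p : Params L K M τ)
    (r : Randomness Ω L K M τ) (t : Fin K) (ω : Ω) : ℂ :=
  ∑ l, (Real.sqrt (p.ρ l t) : ℂ) * (star (hE p r l ω) ⬝ᵥ w P p r l t ω)

/-- Instantaneous power `|BU_{E,1}|²` of the desired signal at the eavesdropper. -/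
def signalE [NeZero K] [MeasurableSpace Ω] (P : Measure Ω) (p : Params L K M τ)
    (r : Randomness Ω L K M τ) (ω : Ω) : ℝ :=
  ‖gainE P p r 0 ω‖ ^ 2

/-- Instantaneous interference-plus-noise power `∑_{t ≠ 1} |UI_{E,t}|² + 1` at the
eavesdropper. -/
def interfE [NeZero K] [MeasurableSpace Ω] (P : Measure Ω) (p : Params L K M τ)
    (r : Randomness Ω L K M τ) (ω : Ω) : ℝ :=
  ∑ t with t ≠ 0, ‖gainE P p r t ω‖ ^ 2 + 1

/-- Instantaneous rate of the eavesdropper with perfect CSI, interference treated as noise. -/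
def instRateE [NeZero K] [MeasurableSpace Ω] (P : Measure Ω) (p : Params L K M τ)
    (r : Randomness Ω L K M τ) (ω : Ω) : ℝ :=
  Real.logb 2 (1 + signalE P p r ω / interfE P p r ω)

/-- Spectral efficiency of the eavesdropper with perfect CSI. -/
def rateE [NeZero K] [MeasurableSpace Ω] (P : Measure Ω) (p : Params L K M τ)
    (r : Randomness Ω L K M τ) : ℝ :=
  ∫ ω, instRateE P p r ω ∂P

/-- The approximation of `rateE` in which signal and interference powers are replaced by
their means. -/
def approxRateE [NeZero K] [MeasurableSpace Ω] (P : Measure Ω) (p : Params L K M τ)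
    (r : Randomness Ω L K M τ) : ℝ :=
  Real.logb 2 (1 + (∫ ω, ‖gainE P p r 0 ω‖ ^ 2 ∂P) /
    (∑ t with t ≠ 0, ∫ ω, ‖gainE P p r t ω‖ ^ 2 ∂P + 1))

/-- Relative dispersion `E[(Z - E Z)² / (Z · E Z)]` of a positive random variable around its
mean. -/
def dispersion [MeasurableSpace Ω] (P : Measure Ω) (Z : Ω → ℝ) : ℝ :=
  ∫ ω, (Z ω - ∫ ω', Z ω' ∂P) ^ 2 / (Z ω * ∫ ω', Z ω' ∂P) ∂P

/-- The APs that serve user `k` by partial zero-forcing. -/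
def servedPZF (p : Params L K M τ) (k : Fin K) : Finset (Fin L) := {l | k ∈ p.S l}

/-- `δ_{l,k}`: one if `k` is a strong user of AP `l`, zero otherwise. -/
def δ (p : Params L K M τ) (l : Fin L) (k : Fin K) : ℝ := if k ∈ p.S l then 1 else 0

/-- Numerator of the closed-form SINR of the eavesdropper. -/
def sinrENum [NeZero K] (p : Params L K M τ) : ℝ :=
  (∑ l, Real.sqrt (p.ρ l 0 * ((M : ℝ) - (p.S l).card) * γE p l)) ^ 2
    + ∑ l, p.ρ l 0 * p.βE l - ∑ l ∈ servedPZF p 0, p.ρ l 0 * γE p l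

/-- The closed-form SINR of the eavesdropper. -/
def sinrE [NeZero K] (p : Params L K M τ) : ℝ :=
  sinrENum p /
    (∑ t with t ≠ 0, ∑ l, p.ρ l t * (p.βE l - δ p l 0 * γE p l) + 1)

end Model

end CellFree

end

noncomputable section

namespace CellFree

/-! ### The standard complex Gaussian law -/

/-! Everything reduces to one orthonormal change of variables. The channel estimates, scaled to unit
variance, and the scaled error of the linear estimate of the eavesdropper's channel from the pilot
of user `0` are linear forms in the i.i.d. entries with orthonormal coefficient rows
(`repMatrix_mul_conjTranspose`), hence again i.i.d. standard complex Gaussian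
(`map_mulVec_stdComplexGaussian`). In these variables the eavesdropper's channel at AP `l` is `√γE •
z + √(βE - γE) • e`, where `z` is the normalized estimate for user `0` and `e` is independent of all
the estimates, hence of the precoders (`hE_eq`).

Fix an AP and put `n = M - |S|`. Since `w` has mean power one, the inner product of `e` with `w` has
mean zero and second moment one, and is uncorrelated with that of `z`
(`moments_add_inner_gaussian`). For `z` there are three cases (`moments_inner_precoder`). If user
`0` is strong, zero forcing makes the inner product almost surely constant: `√n` for its own
precoder, `0` for the others. If it is weak, its own precoder gives `‖V‖²` up to a constant, a Gamma
variable of shape `n`, with mean `√n` and second moment `n + 1` after normalization. The remaining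
precoders do not involve `z`, so isotropy gives mean zero and second moment one.

The normalizing constants come from the law of the squared distance of a Gaussian vector to the span
of independent ones, again Gamma (`hasLaw_sqNorm_orthProj`). A column of the pseudoinverse has the
inverse squared distance as its squared norm, and the mean inverse of a Gamma variable of shape `n +
1` is `1 / n`. Distinct APs are independent, so the second moment of a gain is the square of the sum
of the means plus the sum of the variances (`integral_norm_sq_sum_of_indepFun`).

For the rate, `log (1 + X / Y) = log (X + Y) - log Y`. The error is therefore a difference of two
Jensen gaps, and each gap lies between zero and the dispersion of its variable
(`abs_integral_log_sub_le`). The unit noise keeps `Y ≥ 1`, so the logarithms are integrable. -/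

instance isProbabilityMeasure_complexGaussian (v : NNReal) :
    IsProbabilityMeasure (complexGaussian v) :=
  Measure.isProbabilityMeasure_map
    (Complex.measurableEquivRealProd.symm.measurable.aemeasurable)

lemma measurable_complex_mk : Measurable (fun p : ℝ × ℝ => (⟨p.1, p.2⟩ : ℂ)) :=
  Complex.measurableEquivRealProd.symm.measurable

/-- Dependence on `‖t‖` alone is what yields symmetry of the law and, for vectors, unitary
invariance. -/
lemma charFun_complexGaussian_one (t : ℂ) :
    charFun (complexGaussian 1) t = Complex.exp (-(‖t‖ ^ 2 / 4 : ℝ)) := by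
  have h1 : ∀ a : ℝ, charFun (gaussianReal 0 (1 / 2)) a = Complex.exp (-(a ^ 2 / 4 : ℝ)) := by
    intro a
    rw [charFun_gaussianReal]
    congr 1
    push_cast
    ring
  rw [charFun_apply, complexGaussian, integral_map measurable_complex_mk.aemeasurable
    (by fun_prop)]
  have h2 : ∀ p : ℝ × ℝ, Complex.exp ((inner ℝ (⟨p.1, p.2⟩ : ℂ) t : ℝ) * Complex.I) =
      Complex.exp ((inner ℝ p.1 t.re : ℝ) * Complex.I) *
        Complex.exp ((inner ℝ p.2 t.im : ℝ) * Complex.I) := by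
    intro p
    rw [← Complex.exp_add]
    congr 1
    rw [Complex.inner, Complex.mul_re, Complex.conj_re, Complex.conj_im]
    simp only [RCLike.inner_apply, conj_trivial]
    push_cast
    ring
  simp_rw [h2]
  rw [integral_prod_mul (fun x : ℝ => Complex.exp ((inner ℝ x t.re : ℝ) * Complex.I))
    (fun x : ℝ => Complex.exp ((inner ℝ x t.im : ℝ) * Complex.I)),
    ← charFun_apply, ← charFun_apply, h1, h1, ← Complex.exp_add]
  congr 1
  rw [← Complex.normSq_eq_norm_sq, Complex.normSq_apply]
  push_cast
  ring

/-- The density is radial, so the moments and the Laplace transform of `‖z‖²` become Gamma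
integrals. -/
lemma complexGaussian_one_eq_withDensity :
    complexGaussian 1 =
      volume.withDensity fun z : ℂ => ENNReal.ofReal (Real.pi⁻¹ * Real.exp (-‖z‖ ^ 2)) := by
  have hne : (1 / 2 : NNReal) ≠ 0 := by norm_num
  ext s hs
  rw [complexGaussian, gaussianReal_of_var_ne_zero _ hne,
    prod_withDensity (by fun_prop) (by fun_prop),
    Measure.map_apply measurable_complex_mk hs,
    withDensity_apply _ (measurable_complex_mk hs), withDensity_apply _ hs,
    ← (Complex.volume_preserving_equiv_real_prod.symm _).setLIntegral_comp_preimage hs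
      (by fun_prop)]
  refine lintegral_congr fun p => ?_
  have hn : ‖Complex.measurableEquivRealProd.symm p‖ ^ 2 = p.1 ^ 2 + p.2 ^ 2 := by
    rw [← Complex.normSq_eq_norm_sq, Complex.normSq_apply]
    simp [Complex.measurableEquivRealProd, sq]
  rw [hn, gaussianPDF, gaussianPDF, ← ENNReal.ofReal_mul (gaussianPDFReal_nonneg _ _ _)]
  congr 1
  simp only [gaussianPDFReal]
  have : (2 * Real.pi * ((1 / 2 : NNReal) : ℝ)) = Real.pi := by
    push_cast; ring
  rw [this]
  have hp : (√Real.pi)⁻¹ * (√Real.pi)⁻¹ = Real.pi⁻¹ := by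
    rw [← mul_inv, Real.mul_self_sqrt Real.pi_pos.le]
  rw [mul_mul_mul_comm, hp, ← Real.exp_add]
  congr 2
  push_cast
  ring

lemma integral_complexGaussian_one (f : ℂ → ℝ) :
    ∫ z, f z ∂complexGaussian 1 = Real.pi⁻¹ * ∫ z : ℂ, f z * Real.exp (-‖z‖ ^ 2) := by
  rw [complexGaussian_one_eq_withDensity, integral_withDensity_eq_integral_toReal_smul
    (by fun_prop) (by simp), ← integral_const_mul]
  refine integral_congr_ae (.of_forall fun z => ?_)
  simp only [smul_eq_mul]
  rw [ENNReal.toReal_ofReal (by positivity)]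
  ring

lemma integral_norm_sq_complexGaussian_one : ∫ z, ‖z‖ ^ 2 ∂complexGaussian 1 = 1 := by
  rw [integral_complexGaussian_one]
  have := Complex.integral_rpow_mul_exp_neg_mul_rpow (p := 2) (q := 2) (b := 1)
    (by norm_num) (by norm_num) (by norm_num)
  norm_num at this
  rw [this]
  field_simp

lemma integral_norm_pow_four_complexGaussian_one : ∫ z, ‖z‖ ^ 4 ∂complexGaussian 1 = 2 := by
  rw [integral_complexGaussian_one]
  have := Complex.integral_rpow_mul_exp_neg_mul_rpow (p := 2) (q := (4 : ℕ)) (b := 1)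
    (by norm_num) (by norm_num) (by norm_num)
  -- The Gamma value is `Γ(3) = 2! = 2`.
  rw [show (((4 : ℕ) : ℝ) + 2) / 2 = (2 : ℕ) + 1 by norm_num, Real.Gamma_nat_eq_factorial] at this
  simp only [Real.rpow_natCast, Real.rpow_two] at this
  norm_num at this
  rw [this]
  field_simp

lemma integral_exp_neg_complexGaussian_one {s : ℝ} (hs : 0 ≤ s) :
    ∫ z, Real.exp (-s * ‖z‖ ^ 2) ∂complexGaussian 1 = (1 + s)⁻¹ := by
  rw [integral_complexGaussian_one]
  have := Complex.integral_exp_neg_mul_rpow (p := 2) (b := 1 + s)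
    (by norm_num) (by positivity)
  rw [show (2 : ℝ) / 2 + 1 = (1 : ℕ) + 1 by norm_num, Real.Gamma_nat_eq_factorial] at this
  rw [show (-2 : ℝ) / 2 = -1 by norm_num, Real.rpow_neg_one] at this
  have h2 : ∀ z : ℂ, Real.exp (-s * ‖z‖ ^ 2) * Real.exp (-‖z‖ ^ 2) =
      Real.exp (-(1 + s) * ‖z‖ ^ (2 : ℝ)) := by
    intro z
    rw [← Real.exp_add, Real.rpow_two]
    ring_nf
  simp_rw [h2, this]
  have := Real.pi_ne_zero
  field_simp
  simp

lemma integrable_norm_pow_four_complexGaussian_one :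
    Integrable (fun z : ℂ => ‖z‖ ^ 4) (complexGaussian 1) := by
  -- The integral of a nonintegrable function is `0` by convention, so a nonzero value certifies
  -- integrability.
  refine not_imp_comm.1 integral_undef ?_
  rw [integral_norm_pow_four_complexGaussian_one]
  norm_num

lemma memLp_two_complexGaussian_one : MemLp (fun z : ℂ => z) 2 (complexGaussian 1) := by
  rw [memLp_two_iff_integrable_sq_norm (by fun_prop)]
  refine not_imp_comm.1 integral_undef ?_
  rw [integral_norm_sq_complexGaussian_one]
  norm_num

/-- The characteristic function is even, so the law is invariant under negation. -/
lemma integral_complexGaussian_one_eq_zero : ∫ z : ℂ, z ∂complexGaussian 1 = 0 := by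
  have hneg : (complexGaussian 1).map (fun z => -z) = complexGaussian 1 := by
    refine Measure.ext_of_charFun ?_
    ext t
    rw [charFun_apply, integral_map (by fun_prop) (by fun_prop)]
    have := charFun_complexGaussian_one (-t)
    rw [norm_neg, ← charFun_complexGaussian_one t] at this
    rw [← this, charFun_apply]
    simp
  have h : ∫ z : ℂ, z ∂complexGaussian 1 = -∫ z : ℂ, z ∂complexGaussian 1 := by
    conv_lhs => rw [← hneg, integral_map (by fun_prop) (by fun_prop), integral_neg]
  exact self_eq_neg.1 h

lemma ae_ne_zero_complexGaussian_one : ∀ᵐ z ∂complexGaussian 1, z ≠ 0 := by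
  rw [complexGaussian_one_eq_withDensity]
  exact (withDensity_absolutelyContinuous _ _).ae_le (Measure.ae_ne _ _)

/-! ### Standard complex Gaussian vectors -/

/-- The law of a vector of independent standard complex Gaussian entries. -/
def stdComplexGaussian (ι : Type*) [Fintype ι] : Measure (ι → ℂ) :=
  Measure.pi fun _ => complexGaussian 1

instance (ι : Type*) [Fintype ι] : IsProbabilityMeasure (stdComplexGaussian ι) := by
  unfold stdComplexGaussian; infer_instance

lemma charFun_stdComplexGaussian {ι : Type*} [Fintype ι] (t : EuclideanSpace ℂ ι) :
    charFun ((stdComplexGaussian ι).map (WithLp.toLp 2)) t =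
      Complex.exp (-((∑ i, ‖t i‖ ^ 2) / 4 : ℝ)) := by
  rw [stdComplexGaussian, charFun_pi]
  simp_rw [charFun_complexGaussian_one]
  rw [← Complex.exp_sum]
  congr 1
  push_cast
  rw [Finset.sum_neg_distrib, Finset.sum_div]

lemma ofReal_sum_norm_sq {ι : Type*} [Fintype ι] (v : ι → ℂ) :
    ((∑ i, ‖v i‖ ^ 2 : ℝ) : ℂ) = star v ⬝ᵥ v := by
  push_cast
  refine Finset.sum_congr rfl fun i _ => ?_
  rw [Pi.star_apply, RCLike.star_def, mul_comm, Complex.mul_conj']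

/-- A matrix with orthonormal rows maps the standard complex Gaussian law to the standard complex
Gaussian law. -/
lemma map_mulVec_stdComplexGaussian {ι κ : Type*} [Fintype ι] [Fintype κ] [DecidableEq κ]
    (C : Matrix κ ι ℂ) (hC : C * C.conjTranspose = 1) :
    (stdComplexGaussian ι).map (fun x => C.mulVec x) = stdComplexGaussian κ := by
  have hm : Measurable (fun x : ι → ℂ => C.mulVec x) := by
    refine measurable_pi_lambda _ fun k => ?_
    simp only [Matrix.mulVec, dotProduct]
    fun_prop
  have := Measure.isProbabilityMeasure_map (μ := stdComplexGaussian ι) hm.aemeasurable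
  refine (charFun_eq_pi_iff (μ := fun _ : κ => complexGaussian 1)).1 fun t => ?_
  simp_rw [charFun_complexGaussian_one]
  rw [← Complex.exp_sum, charFun_apply,
    integral_map (by fun_prop) (by fun_prop), integral_map hm.aemeasurable (by fun_prop)]
  -- The adjoint moves `C` onto the frequency: `⟨C x, t⟩ = ⟨x, Cᴴ t⟩`. Since `C Cᴴ = 1`, the
  -- frequency `Cᴴ t` has the norm of `t`, and the characteristic function sees only this norm.
  set s : EuclideanSpace ℂ ι := WithLp.toLp 2 (C.conjTranspose.mulVec t.ofLp) with hs
  have hc := charFun_stdComplexGaussian s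
  rw [charFun_apply, integral_map (by fun_prop) (by fun_prop)] at hc
  have hi : ∀ x : ι → ℂ, (inner ℝ (WithLp.toLp 2 (C.mulVec x) : PiLp 2 fun _ : κ => ℂ) t : ℝ) =
      inner ℝ (WithLp.toLp 2 x : PiLp 2 fun _ : ι => ℂ) s := by
    intro x
    simp only [PiLp.inner_apply, Complex.inner]
    rw [← Complex.re_sum, ← Complex.re_sum]
    congr 1
    have h := Matrix.dotProduct_mulVec (star x) C.conjTranspose t.ofLp
    rw [← Matrix.star_mulVec] at h
    simp only [dotProduct, Pi.star_apply] at h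
    simp only [hs]
    rw [Finset.sum_congr rfl fun i _ => mul_comm (t.ofLp i) _,
      Finset.sum_congr rfl fun i _ => mul_comm (C.conjTranspose.mulVec t.ofLp i) _]
    exact h.symm
  have hn : ∑ i, ‖s i‖ ^ 2 = ∑ k, ‖t k‖ ^ 2 := by
    have h2 : ((∑ i, ‖s i‖ ^ 2 : ℝ) : ℂ) = ((∑ k, ‖t k‖ ^ 2 : ℝ) : ℂ) := by
      rw [ofReal_sum_norm_sq, ofReal_sum_norm_sq, hs]
      simp only
      rw [Matrix.star_mulVec, Matrix.conjTranspose_conjTranspose, ← Matrix.dotProduct_mulVec,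
        Matrix.mulVec_mulVec, hC, Matrix.one_mulVec]
    exact_mod_cast h2
  simp_rw [hi]
  rw [hc, hn]
  congr 1
  push_cast
  rw [Finset.sum_neg_distrib, Finset.sum_div]

/-! ### The law of the squared norm of a standard complex Gaussian vector -/

lemma sqNorm_nonneg {M : ℕ} (v : Fin M → ℂ) : 0 ≤ sqNorm v := by
  unfold sqNorm; positivity

lemma measurable_sqNorm {M : ℕ} : Measurable (sqNorm (M := M)) := by
  unfold sqNorm; fun_prop

lemma sqNorm_smul {M : ℕ} (c : ℂ) (v : Fin M → ℂ) : sqNorm (c • v) = ‖c‖ ^ 2 * sqNorm v := by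
  simp [sqNorm, mul_pow, Finset.mul_sum]

lemma ofReal_sqNorm {M : ℕ} (v : Fin M → ℂ) : (sqNorm v : ℂ) = star v ⬝ᵥ v :=
  ofReal_sum_norm_sq v

/-- The law of `‖z‖²` for a standard complex Gaussian vector `z` of length `n`, which is the Gamma
law of shape `n` and rate `1`. -/
def sqNormLaw (n : ℕ) : Measure ℝ := (stdComplexGaussian (Fin n)).map sqNorm

instance isProbabilityMeasure_sqNormLaw (n : ℕ) : IsProbabilityMeasure (sqNormLaw n) :=
  Measure.isProbabilityMeasure_map measurable_sqNorm.aemeasurable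

lemma ae_pos_sqNormLaw {n : ℕ} (hn : 1 ≤ n) : ∀ᵐ x ∂sqNormLaw n, 0 < x := by
  rw [sqNormLaw, ae_map_iff measurable_sqNorm.aemeasurable measurableSet_Ioi]
  have h := (measurePreserving_eval (fun _ : Fin n => complexGaussian 1)
    ⟨0, hn⟩).quasiMeasurePreserving.ae ae_ne_zero_complexGaussian_one
  filter_upwards [h] with z hz
  refine lt_of_lt_of_le (b := ‖z ⟨0, hn⟩‖ ^ 2) (by have : z ⟨0, hn⟩ ≠ 0 := hz; positivity) ?_
  exact Finset.single_le_sum (f := fun i => ‖z i‖ ^ 2) (fun i _ => by positivity)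
    (Finset.mem_univ _)

lemma memLp_two_norm_sq_eval {n : ℕ} (i : Fin n) :
    MemLp (fun z : Fin n → ℂ => ‖z i‖ ^ 2) 2 (stdComplexGaussian (Fin n)) := by
  rw [memLp_two_iff_integrable_sq
    (by fun_prop : Measurable fun z : Fin n → ℂ => ‖z i‖ ^ 2).aestronglyMeasurable]
  refine (integrable_comp_eval (μ := fun _ : Fin n => complexGaussian 1) (i := i)
    integrable_norm_pow_four_complexGaussian_one).congr (.of_forall fun z => ?_)
  ring

lemma memLp_two_sqNorm (n : ℕ) : MemLp (sqNorm (M := n)) 2 (stdComplexGaussian (Fin n)) :=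
  memLp_finsetSum _ fun i _ => memLp_two_norm_sq_eval i

lemma memLp_two_sqNormLaw (n : ℕ) : MemLp (fun x : ℝ => x) 2 (sqNormLaw n) := by
  rw [sqNormLaw, memLp_map_measure_iff (by fun_prop) measurable_sqNorm.aemeasurable]
  exact memLp_two_sqNorm n

lemma integral_norm_sq_eval {n : ℕ} (i : Fin n) :
    ∫ z : Fin n → ℂ, ‖z i‖ ^ 2 ∂stdComplexGaussian (Fin n) = 1 := by
  rw [← integral_norm_sq_complexGaussian_one]
  exact integral_comp_eval (μ := fun _ : Fin n => complexGaussian 1) (i := i)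
    (f := fun z : ℂ => ‖z‖ ^ 2) (by fun_prop)

lemma integral_sqNormLaw (n : ℕ) : ∫ x, x ∂sqNormLaw n = n := by
  rw [sqNormLaw, integral_map measurable_sqNorm.aemeasurable (by fun_prop)]
  simp only [sqNorm]
  rw [integral_finsetSum _ fun i _ => (memLp_two_norm_sq_eval i).integrable (by norm_num)]
  simp [integral_norm_sq_eval]

/-- The coordinates `‖z i‖²` are independent with mean `1` and variance `2 - 1 = 1`, so the variance
of the sum is `n` and its second moment `n + n²`. -/
lemma integral_sq_sqNormLaw (n : ℕ) : ∫ x, x ^ 2 ∂sqNormLaw n = n * (n + 1) := by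
  set W : Fin n → (Fin n → ℂ) → ℝ := fun i z => ‖z i‖ ^ 2
  have hW : sqNorm (M := n) = ∑ i, W i := by
    ext z; simp [sqNorm, W]
  have hind : iIndepFun W (stdComplexGaussian (Fin n)) :=
    iIndepFun_pi (μ := fun _ : Fin n => complexGaussian 1) (X := fun _ z => ‖z‖ ^ 2)
      fun i => by fun_prop
  have hvar : ∀ i, Var[W i; stdComplexGaussian (Fin n)] = 1 := by
    intro i
    rw [variance_eq_sub (memLp_two_norm_sq_eval i)]
    have h4 : ∫ z : Fin n → ℂ, (W i ^ 2) z ∂stdComplexGaussian (Fin n) = 2 := by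
      rw [← integral_norm_pow_four_complexGaussian_one]
      refine Eq.trans ?_ (integral_comp_eval (μ := fun _ : Fin n => complexGaussian 1) (i := i)
        (f := fun z : ℂ => ‖z‖ ^ 4) (by fun_prop))
      refine integral_congr_ae (.of_forall fun z => ?_)
      simp only [W, Pi.pow_apply]
      ring
    rw [h4, integral_norm_sq_eval]
    norm_num
  have h := IndepFun.variance_sum (X := W) (s := Finset.univ) (fun i _ => memLp_two_norm_sq_eval i)
    (fun i _ j _ hij => hind.indepFun hij)
  have hint := integral_sqNormLaw n
  rw [sqNormLaw, integral_map measurable_sqNorm.aemeasurable (by fun_prop)] at hint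
  simp_rw [hvar] at h
  rw [← hW, variance_eq_sub (memLp_two_sqNorm n), hint] at h
  rw [sqNormLaw, integral_map measurable_sqNorm.aemeasurable (by fun_prop)]
  simp only [Pi.pow_apply, Finset.sum_const, Finset.card_univ, Fintype.card_fin, nsmul_eq_mul,
    mul_one] at h
  linarith

lemma integral_exp_neg_mul_sqNormLaw (n : ℕ) {s : ℝ} (hs : 0 ≤ s) :
    ∫ x, Real.exp (-s * x) ∂sqNormLaw n = ((1 + s) ^ n)⁻¹ := by
  rw [sqNormLaw, integral_map measurable_sqNorm.aemeasurable (by fun_prop)]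
  simp only [sqNorm, Finset.mul_sum, Real.exp_sum]
  rw [stdComplexGaussian, integral_fintype_prod_eq_prod (fun _ z => Real.exp (-s * ‖z‖ ^ 2))]
  simp only [integral_exp_neg_complexGaussian_one hs, Finset.prod_const, Finset.card_univ,
    Fintype.card_fin, inv_pow]

lemma lintegral_exp_neg_mul_Ioi {x : ℝ} (hx : 0 < x) :
    ∫⁻ s in Set.Ioi (0 : ℝ), ENNReal.ofReal (Real.exp (-s * x)) = ENNReal.ofReal x⁻¹ := by
  have h := integral_exp_mul_Ioi (a := -x) (by linarith) 0
  have hi := integrableOn_exp_mul_Ioi (a := -x) (by linarith) 0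
  rw [mul_zero, Real.exp_zero] at h
  have := ofReal_integral_eq_lintegral_ofReal hi (.of_forall fun _ => (Real.exp_pos _).le)
  rw [h] at this
  rw [show x⁻¹ = -1 / -x by rw [neg_div_neg_eq, one_div], this]
  congr 1
  ext s
  congr 2
  ring

lemma lintegral_inv_one_add_pow_Ioi {n : ℕ} (hn : 2 ≤ n) :
    ∫⁻ s in Set.Ioi (0 : ℝ), ENNReal.ofReal ((1 + s) ^ n)⁻¹ = ENNReal.ofReal ((n : ℝ) - 1)⁻¹ := by
  have hn' : (2 : ℝ) ≤ n := by exact_mod_cast hn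
  have ha : (-(n : ℝ)) < -1 := by linarith
  have h := integral_Ioi_rpow_of_lt ha one_pos
  have hi := integrableOn_Ioi_rpow_of_lt ha one_pos
  have key := ofReal_integral_eq_lintegral_ofReal hi
    ((ae_restrict_iff' measurableSet_Ioi).2 (.of_forall fun t (ht : 1 < t) =>
      (Real.rpow_nonneg (by linarith) _)))
  rw [h] at key
  have hpre : (fun s : ℝ => 1 + s) ⁻¹' Set.Ioi 1 = Set.Ioi 0 := by
    ext s; simp
  have hc := (measurePreserving_add_left (volume : Measure ℝ) 1).setLIntegral_comp_preimage
    (s := Set.Ioi (1 : ℝ)) measurableSet_Ioi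
    (f := fun t : ℝ => ENNReal.ofReal (t ^ (-(n : ℝ)))) (by fun_prop)
  rw [hpre, ← key] at hc
  have : ((n : ℝ) - 1)⁻¹ = -1 ^ (-(n : ℝ) + 1) / (-(n : ℝ) + 1) := by
    rw [Real.one_rpow, show -(n : ℝ) + 1 = -((n : ℝ) - 1) by ring, neg_div_neg_eq, one_div]
  rw [this, ← hc]
  refine setLIntegral_congr_fun measurableSet_Ioi fun s (hs : 0 < s) => ?_
  rw [Real.rpow_neg (by linarith), Real.rpow_natCast]

/-- Write `1 / x` as the integral of `exp (-s x)` over `s > 0` and exchange the integrals by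
Tonelli. The Laplace transform `(1 + s)⁻ⁿ` is integrable in `s` exactly from `n = 2` on. Working in
`ENNReal` avoids assuming integrability beforehand. -/
lemma lintegral_inv_sqNormLaw {n : ℕ} (hn : 2 ≤ n) :
    ∫⁻ x, ENNReal.ofReal x⁻¹ ∂sqNormLaw n = ENNReal.ofReal ((n : ℝ) - 1)⁻¹ := by
  calc ∫⁻ x, ENNReal.ofReal x⁻¹ ∂sqNormLaw n
      = ∫⁻ x, (∫⁻ s in Set.Ioi (0 : ℝ), ENNReal.ofReal (Real.exp (-s * x))) ∂sqNormLaw n := by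
        refine lintegral_congr_ae ?_
        filter_upwards [ae_pos_sqNormLaw (n := n) (by lia)] with x hx
        rw [lintegral_exp_neg_mul_Ioi hx]
    _ = ∫⁻ s in Set.Ioi (0 : ℝ), ∫⁻ x, ENNReal.ofReal (Real.exp (-s * x)) ∂sqNormLaw n :=
        lintegral_lintegral_swap (by fun_prop)
    _ = ∫⁻ s in Set.Ioi (0 : ℝ), ENNReal.ofReal ((1 + s) ^ n)⁻¹ := by
        refine setLIntegral_congr_fun measurableSet_Ioi fun s (hs : 0 < s) => ?_
        rw [← integral_exp_neg_mul_sqNormLaw n hs.le, ofReal_integral_eq_lintegral_ofReal]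
        · refine not_imp_comm.1 integral_undef ?_
          rw [integral_exp_neg_mul_sqNormLaw n hs.le]
          positivity
        · exact .of_forall fun _ => (Real.exp_pos _).le
    _ = _ := lintegral_inv_one_add_pow_Ioi hn

lemma integral_inv_sqNormLaw {n : ℕ} (hn : 2 ≤ n) :
    ∫ x, x⁻¹ ∂sqNormLaw n = ((n : ℝ) - 1)⁻¹ := by
  have hn' : (2 : ℝ) ≤ n := by exact_mod_cast hn
  rw [integral_eq_lintegral_of_nonneg_ae _ (by fun_prop), lintegral_inv_sqNormLaw hn,
    ENNReal.toReal_ofReal (by rw [inv_nonneg]; linarith)]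
  filter_upwards [ae_pos_sqNormLaw (n := n) (by lia)] with x hx
  exact inv_nonneg.2 hx.le

lemma integrable_inv_sqNormLaw {n : ℕ} (hn : 2 ≤ n) :
    Integrable (fun x : ℝ => x⁻¹) (sqNormLaw n) := by
  have hn' : (2 : ℝ) ≤ n := by exact_mod_cast hn
  refine not_imp_comm.1 integral_undef ?_
  rw [integral_inv_sqNormLaw hn]
  exact inv_ne_zero (by linarith)

open scoped Matrix

/-! ### Measurability of matrix operations -/

instance instMeasurableSpaceMatrix (m n : Type*) : MeasurableSpace (Matrix m n ℂ) :=
  inferInstanceAs (MeasurableSpace (m → n → ℂ))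

instance instBorelSpaceMatrix (m n : Type*) [Finite m] [Finite n] : BorelSpace (Matrix m n ℂ) :=
  inferInstanceAs (BorelSpace (m → n → ℂ))

lemma measurable_matrix_iff {α m n : Type*} [MeasurableSpace α] {f : α → Matrix m n ℂ} :
    Measurable f ↔ ∀ i j, Measurable fun x => f x i j := by
  refine ⟨fun h i j => ?_, fun h =>
    measurable_pi_lambda (f : α → m → n → ℂ) fun i => measurable_pi_lambda _ fun j => h i j⟩
  exact (measurable_pi_apply j).comp ((measurable_pi_apply i).comp (f := (f : α → m → n → ℂ)) h)

/-- Cramer's rule gives continuous numerator and determinant; the scalar inverse, with value `0` at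
`0`, is measurable, so singular matrices need no separate treatment. -/
lemma measurable_matrix_inv {n : Type*} [Fintype n] [DecidableEq n] :
    Measurable fun A : Matrix n n ℂ => A⁻¹ := by
  refine measurable_matrix_iff.2 fun i j => ?_
  simp only [Matrix.inv_def, Ring.inverse_eq_inv', Matrix.smul_apply, smul_eq_mul]
  have h1 : Measurable fun A : Matrix n n ℂ => A.det :=
    (continuous_id.matrix_det).measurable
  have h2 : Measurable fun A : Matrix n n ℂ => A.adjugate i j :=
    (continuous_id.matrix_adjugate.matrix_elem i j).measurable
  exact h1.inv.mul h2

/-! ### The orthogonal projection off the columns of a matrix -/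

section OrthProj

variable {M : ℕ} {ι : Type*} [Fintype ι] [DecidableEq ι]

/-- The projection onto the orthogonal complement of the columns of `H`, provided that these are
linearly independent. -/
def orthProj (H : Matrix (Fin M) ι ℂ) : Matrix (Fin M) (Fin M) ℂ :=
  1 - H * (H.conjTranspose * H)⁻¹ * H.conjTranspose

lemma measurable_gram_inv :
    Measurable fun H : Matrix (Fin M) ι ℂ => (H.conjTranspose * H)⁻¹ := by
  refine measurable_matrix_inv.comp (Continuous.measurable ?_)
  fun_prop

lemma measurable_pinv :
    Measurable fun H : Matrix (Fin M) ι ℂ => H * (H.conjTranspose * H)⁻¹ := by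
  refine measurable_matrix_iff.2 fun i j => ?_
  simp only [Matrix.mul_apply (M := _) (N := (_ : Matrix ι ι ℂ)⁻¹)]
  refine Finset.measurable_sum _ fun k _ => Measurable.mul ?_ ?_
  · exact (continuous_id.matrix_elem i k).measurable
  · exact measurable_matrix_iff.1 measurable_gram_inv k j

lemma measurable_orthProj : Measurable fun H : Matrix (Fin M) ι ℂ => orthProj H := by
  refine measurable_matrix_iff.2 fun i j => ?_
  simp only [orthProj, Matrix.sub_apply,
    Matrix.mul_apply (M := (_ : Matrix (Fin M) ι ℂ)) (N := Matrix.conjTranspose _) (i := i)]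
  refine measurable_const.sub (Finset.measurable_sum _ fun k _ => Measurable.mul ?_ ?_)
  · exact measurable_matrix_iff.1 measurable_pinv i k
  · exact (continuous_id.matrix_conjTranspose.matrix_elem k j).measurable

/-- Invertibility of the Gram matrix is not needed here: its inverse is Hermitian even as the
default value `0`. Idempotence and the trace formula do need it. -/
lemma isHermitian_orthProj (H : Matrix (Fin M) ι ℂ) : (orthProj H).IsHermitian := by
  have h := (Matrix.isHermitian_conjTranspose_mul_self H).inv
  unfold orthProj
  refine Matrix.isHermitian_one.sub ?_
  exact Matrix.isHermitian_mul_mul_conjTranspose H h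

variable {H : Matrix (Fin M) ι ℂ}

lemma orthProj_mul_self_eq_zero (hH : IsUnit (H.conjTranspose * H).det) : orthProj H * H = 0 := by
  rw [orthProj, Matrix.sub_mul, Matrix.one_mul, Matrix.mul_assoc, Matrix.mul_assoc,
    Matrix.nonsing_inv_mul _ hH, Matrix.mul_one, sub_self]

lemma conjTranspose_mul_orthProj (hH : IsUnit (H.conjTranspose * H).det) :
    H.conjTranspose * orthProj H = 0 := by
  rw [← (isHermitian_orthProj H).eq, ← Matrix.conjTranspose_mul, orthProj_mul_self_eq_zero hH,
    Matrix.conjTranspose_zero]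

lemma orthProj_mul_orthProj (hH : IsUnit (H.conjTranspose * H).det) :
    orthProj H * orthProj H = orthProj H := by
  nth_rw 1 [orthProj]
  rw [Matrix.sub_mul, Matrix.one_mul, Matrix.mul_assoc _ _ (orthProj H),
    conjTranspose_mul_orthProj hH, Matrix.mul_zero, sub_zero]

/-- By cyclicity the subtracted trace is that of the identity on `ι`. -/
lemma trace_orthProj (hH : IsUnit (H.conjTranspose * H).det) :
    (orthProj H).trace = M - Fintype.card ι := by
  rw [orthProj, Matrix.trace_sub, Matrix.trace_one, Matrix.trace_mul_cycle,
    Matrix.mul_nonsing_inv _ hH, Matrix.trace_one, Fintype.card_fin]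

lemma star_dotProduct_orthProj_mulVec (hH : IsUnit (H.conjTranspose * H).det)
    (x y : Fin M → ℂ) :
    star (orthProj H *ᵥ x) ⬝ᵥ (orthProj H *ᵥ y) = star x ⬝ᵥ (orthProj H *ᵥ y) := by
  rw [Matrix.star_mulVec, (isHermitian_orthProj H).eq, ← Matrix.dotProduct_mulVec,
    Matrix.mulVec_mulVec, orthProj_mul_orthProj hH]

/-- The vector of the pseudoinverse of `H` that belongs to the column `k` has as its norm the
inverse of the distance of that column to the span of the others. -/
lemma sqNorm_pinv_mulVec_single (k : ι) (hH : IsUnit (H.conjTranspose * H).det)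
    (hH' : IsUnit ((H.submatrix id (Subtype.val : {i // i ≠ k} → ι)).conjTranspose *
      H.submatrix id (Subtype.val : {i // i ≠ k} → ι)).det) :
    sqNorm ((H * (H.conjTranspose * H)⁻¹) *ᵥ Pi.single k 1) =
      (sqNorm (orthProj (H.submatrix id (Subtype.val : {i // i ≠ k} → ι)) *ᵥ H.col k))⁻¹ := by
  set H' := H.submatrix id (Subtype.val : {i // i ≠ k} → ι) with hH'def
  set c : ι → ℂ := (H.conjTranspose * H)⁻¹ *ᵥ Pi.single k 1 with hc
  set v : Fin M → ℂ := (H * (H.conjTranspose * H)⁻¹) *ᵥ Pi.single k 1 with hv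
  set u : Fin M → ℂ := orthProj H' *ᵥ H.col k with hu
  have hvc : v = H *ᵥ c := by rw [hv, hc, Matrix.mulVec_mulVec]
  have hHv : H.conjTranspose *ᵥ v = Pi.single k 1 := by
    rw [hv, Matrix.mulVec_mulVec, ← Matrix.mul_assoc, Matrix.mul_nonsing_inv _ hH,
      Matrix.one_mulVec]
  have hH'v : H'.conjTranspose *ᵥ v = 0 := by
    ext i
    have := congrFun hHv i.1
    rw [Pi.single_eq_of_ne i.2] at this
    exact this
  have hQv : orthProj H' *ᵥ v = v := by
    rw [orthProj, Matrix.sub_mulVec, Matrix.one_mulVec, ← Matrix.mulVec_mulVec, hH'v,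
      Matrix.mulVec_zero, sub_zero]
  have hcols : ∀ i, i ≠ k → orthProj H' *ᵥ H.col i = 0 := by
    intro i hi
    ext m
    exact congrFun (congrFun (orthProj_mul_self_eq_zero hH') m) ⟨i, hi⟩
  -- The vector `v` is orthogonal to the other columns, hence fixed by the projection. It is also a
  -- combination of all columns, of which the projection keeps only column `k`.
  have hvu : v = c k • u := by
    have hsum : H *ᵥ c = ∑ i, c i • H.col i := by
      ext m
      simp [Matrix.mulVec, dotProduct, mul_comm]
    rw [← hQv, hvc, hsum, Matrix.mulVec_sum, Finset.sum_eq_single k]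
    · rw [Matrix.mulVec_smul]
    · intro i _ hi
      rw [Matrix.mulVec_smul, hcols i hi, smul_zero]
    · simp
  have h1 : star (H.col k) ⬝ᵥ v = 1 := by
    have := congrFun hHv k
    rw [Pi.single_eq_same] at this
    exact this
  -- Pairing `v = c k • u` with column `k` gives `1`. Hence `‖v‖² = ‖c k‖² ‖u‖² = ‖c k‖ = 1 / ‖u‖²`.
  have h2 : c k * sqNorm u = 1 := by
    rw [← h1, ← hQv, ← star_dotProduct_orthProj_mulVec hH', hQv, ← hu, hvu, dotProduct_smul,
      ← ofReal_sqNorm, smul_eq_mul]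
  have h3 : ‖c k‖ * sqNorm u = 1 := by
    have := congrArg norm h2
    rwa [norm_mul, Complex.norm_real, Real.norm_of_nonneg (sqNorm_nonneg u), norm_one] at this
  rw [hvu, sqNorm_smul, sq, mul_assoc, h3, mul_one]
  exact eq_inv_of_mul_eq_one_left h3

end OrthProj

/-- A Hermitian projection of trace `n` factors through an isometry on `ℂⁿ`. -/
lemma exists_isometry_of_projection {M n : ℕ} {Q : Matrix (Fin M) (Fin M) ℂ} (hQ : Q.IsHermitian)
    (hQQ : Q * Q = Q) (htr : Q.trace = n) :
    ∃ C : Matrix (Fin n) (Fin M) ℂ, C * C.conjTranspose = 1 ∧ C.conjTranspose * C = Q := by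
  set U : Matrix (Fin M) (Fin M) ℂ := (hQ.eigenvectorUnitary).1 with hU
  have hUU : star U * U = 1 := Unitary.coe_star_mul_self _
  have hsp : Q = U * Matrix.diagonal (fun i => (hQ.eigenvalues i : ℂ)) * star U := by
    conv_lhs => rw [hQ.spectral_theorem, Unitary.conjStarAlgAut_apply]
    rfl
  have hev : ∀ i, hQ.eigenvalues i = 0 ∨ hQ.eigenvalues i = 1 := by
    intro i
    have hD : Matrix.diagonal (fun i => (hQ.eigenvalues i : ℂ)) = star U * Q * U := by
      conv_rhs => rw [hsp]
      rw [← Matrix.mul_assoc, ← Matrix.mul_assoc, hUU, Matrix.one_mul, Matrix.mul_assoc, hUU,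
        Matrix.mul_one]
    have hDD : Matrix.diagonal (fun i => (hQ.eigenvalues i : ℂ)) *
        Matrix.diagonal (fun i => (hQ.eigenvalues i : ℂ)) =
        Matrix.diagonal (fun i => (hQ.eigenvalues i : ℂ)) := by
      have hUU' : U * star U = 1 := Unitary.coe_mul_star_self _
      calc _ = star U * Q * (U * star U) * Q * U := by
            rw [hD]; simp only [Matrix.mul_assoc]
        _ = star U * (Q * Q) * U := by rw [hUU', Matrix.mul_one, Matrix.mul_assoc (star U)]
        _ = _ := by rw [hQQ, hD]
    rw [Matrix.diagonal_mul_diagonal] at hDD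
    have h : ((hQ.eigenvalues i : ℂ)) * hQ.eigenvalues i = hQ.eigenvalues i :=
      congrFun (Matrix.diagonal_injective hDD) i
    have h' : hQ.eigenvalues i * hQ.eigenvalues i = hQ.eigenvalues i := by exact_mod_cast h
    have h'' : hQ.eigenvalues i * (hQ.eigenvalues i - 1) = 0 := by linarith
    rcases mul_eq_zero.1 h'' with h | h
    exacts [Or.inl h, Or.inr (by linarith)]
  have hval : ∀ i, (hQ.eigenvalues i : ℂ) = if hQ.eigenvalues i = 1 then 1 else 0 := by
    intro i
    rcases hev i with h | h <;> simp [h]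
  have hcard : Fintype.card {i // hQ.eigenvalues i = 1} = n := by
    have h := hQ.trace_eq_sum_eigenvalues
    rw [htr] at h
    have h2 : (n : ℂ) = (Finset.univ.filter fun i => hQ.eigenvalues i = 1).card := by
      rw [h, ← Finset.sum_boole]
      exact Finset.sum_congr rfl fun i _ => hval i
    rw [Fintype.card_subtype]
    exact_mod_cast h2.symm
  let e : Fin n ≃ {i // hQ.eigenvalues i = 1} := (Fintype.equivFinOfCardEq hcard).symm
  -- The rows of `C` are the conjugated eigenvectors of eigenvalue one; the trace counts them, since
  -- idempotence leaves only the eigenvalues `0` and `1`.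
  refine ⟨(star U).submatrix (fun j => (e j).1) id, ?_, ?_⟩
  · ext a b
    have h := congrFun (congrFun hUU (e a)) (e b)
    simp only [Matrix.mul_apply, Matrix.one_apply, Matrix.star_apply, Subtype.val_inj,
      EmbeddingLike.apply_eq_iff_eq] at h
    simpa [Matrix.mul_apply, Matrix.one_apply] using h
  · conv_rhs => rw [hsp]
    ext a b
    simp only [Matrix.mul_apply (M := U * _), Matrix.mul_diagonal, hval]
    rw [Matrix.mul_apply]
    simp only [Matrix.conjTranspose_apply, Matrix.submatrix_apply, id, Matrix.star_apply,
      star_star, mul_ite, mul_one, mul_zero, ite_mul, zero_mul]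
    rw [← Finset.sum_filter,
      Finset.sum_subtype (p := fun i => hQ.eigenvalues i = 1) _ (by simp) _]
    exact e.sum_comp fun i => U a i * star (U b i)

/-- With `Q = Cᴴ C`, both `‖Q y‖²` and `‖C y‖²` equal `⟨y, Q y⟩`, and `C y` is standard Gaussian of
length `n`. -/
lemma map_sqNorm_projection {M n : ℕ} {Q : Matrix (Fin M) (Fin M) ℂ} (hQ : Q.IsHermitian)
    (hQQ : Q * Q = Q) (htr : Q.trace = n) :
    (stdComplexGaussian (Fin M)).map (fun y => sqNorm (Q *ᵥ y)) = sqNormLaw n := by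
  obtain ⟨C, hC, hCQ⟩ := exists_isometry_of_projection hQ hQQ htr
  have hm : Measurable fun y : Fin M → ℂ => C *ᵥ y :=
    (continuous_const.matrix_mulVec continuous_id).measurable
  rw [sqNormLaw, ← map_mulVec_stdComplexGaussian C hC, Measure.map_map measurable_sqNorm hm]
  congr 1
  ext y
  have h : (sqNorm (Q *ᵥ y) : ℂ) = sqNorm (C *ᵥ y) := by
    rw [ofReal_sqNorm, ofReal_sqNorm, Matrix.star_mulVec, Matrix.star_mulVec, hQ.eq,
      ← Matrix.dotProduct_mulVec, ← Matrix.dotProduct_mulVec, Matrix.mulVec_mulVec,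
      Matrix.mulVec_mulVec, hQQ, hCQ]
  exact_mod_cast h

section RandomProjection

variable {M : ℕ} {ι : Type*} [Fintype ι] [DecidableEq ι]

lemma measurable_orthProj_mulVec {α : Type*} [MeasurableSpace α] {f : α → Matrix (Fin M) ι ℂ}
    {g : α → Fin M → ℂ} (hf : Measurable f) (hg : Measurable g) :
    Measurable fun x => orthProj (f x) *ᵥ g x := by
  refine measurable_pi_lambda _ fun i => ?_
  simp only [Matrix.mulVec, dotProduct]
  refine Finset.measurable_sum _ fun j _ => Measurable.mul ?_ ?_
  · exact measurable_matrix_iff.1 (measurable_orthProj.comp hf) i j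
  · exact (measurable_pi_apply j).comp hg

/-- A standard complex Gaussian vector, projected off independent random vectors. -/
lemma hasLaw_sqNorm_orthProj {Ω : Type*} [MeasurableSpace Ω] {P : Measure Ω}
    [IsProbabilityMeasure P] {U : Ω → Matrix (Fin M) ι ℂ} {y : Ω → Fin M → ℂ}
    (hU : AEMeasurable U P) (hy : HasLaw y (stdComplexGaussian (Fin M)) P) (hind : IndepFun U y P)
    (hdet : ∀ᵐ ω ∂P, IsUnit ((U ω)ᴴ * U ω).det) {n : ℕ} (hn : n + Fintype.card ι = M) :
    HasLaw (fun ω => sqNorm (orthProj (U ω) *ᵥ y ω)) (sqNormLaw n) P := by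
  have hmeas : Measurable fun q : Matrix (Fin M) ι ℂ × (Fin M → ℂ) =>
      sqNorm (orthProj q.1 *ᵥ q.2) :=
    measurable_sqNorm.comp (measurable_orthProj_mulVec measurable_fst measurable_snd)
  have hpair : AEMeasurable (fun ω => (U ω, y ω)) P := hU.prodMk hy.aemeasurable
  have hae : AEMeasurable (fun ω => sqNorm (orthProj (U ω) *ᵥ y ω)) P :=
    hmeas.comp_aemeasurable (f := fun ω => (U ω, y ω)) hpair
  refine ⟨hae, ?_⟩
  ext s hs
  have hdet' : ∀ᵐ u ∂P.map U, IsUnit (uᴴ * u).det := by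
    rw [ae_map_iff hU]
    · exact hdet
    · have : Measurable fun u : Matrix (Fin M) ι ℂ => (uᴴ * u).det :=
        Continuous.measurable (by fun_prop)
      simp only [isUnit_iff_ne_zero]
      exact this (measurableSet_singleton 0).compl
  have := Measure.isProbabilityMeasure_map (μ := P) hU
  have h1 : P.map (fun ω => sqNorm (orthProj (U ω) *ᵥ y ω)) =
      ((P.map U).prod (stdComplexGaussian (Fin M))).map
        (fun q : Matrix (Fin M) ι ℂ × (Fin M → ℂ) => sqNorm (orthProj q.1 *ᵥ q.2)) := by
    rw [← hy.map_eq, ← (indepFun_iff_map_prod_eq_prod_map_map hU hy.aemeasurable).1 hind,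
      AEMeasurable.map_map_of_aemeasurable hmeas.aemeasurable hpair,
      Function.comp_def]
  rw [h1, Measure.map_apply hmeas hs, Measure.prod_apply (hmeas hs)]
  -- By independence `U` may be frozen at `u`. The conditional law depends only on the rank of the
  -- projection, so it is the same for almost every `u`.
  have h2 : ∀ᵐ u ∂P.map U, stdComplexGaussian (Fin M) (Prod.mk u ⁻¹'
      ((fun q : Matrix (Fin M) ι ℂ × (Fin M → ℂ) => sqNorm (orthProj q.1 *ᵥ q.2)) ⁻¹' s)) =
      sqNormLaw n s := by
    filter_upwards [hdet'] with u hu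
    have htr : (orthProj u).trace = n := by
      rw [trace_orthProj hu, ← hn]
      push_cast
      ring
    have hmu : Measurable fun x => sqNorm (orthProj u *ᵥ x) :=
      measurable_sqNorm.comp (measurable_orthProj_mulVec measurable_const measurable_id)
    rw [← map_sqNorm_projection (isHermitian_orthProj u) (orthProj_mul_orthProj hu) htr,
      Measure.map_apply hmu hs]
    rfl
  rw [lintegral_congr_ae h2, lintegral_const, measure_univ, mul_one]

end RandomProjection

/-! ### Independent Gaussian columns -/

/-- The matrix whose columns are the vectors `v (f i)`. -/
def colMat {M : ℕ} {ι κ : Type*} (f : ι → κ) (v : κ → Fin M → ℂ) : Matrix (Fin M) ι ℂ :=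
  Matrix.of fun m i => v (f i) m

/-- Independent random vectors `v k = c k • z k` with `z k` standard complex Gaussian and
`c k ≠ 0`. -/
structure IsGaussianFamily {Ω : Type*} [MeasurableSpace Ω] {M : ℕ} {κ : Type*} (P : Measure Ω)
    (c : κ → ℂ) (z v : κ → Ω → Fin M → ℂ) : Prop where
  indep : iIndepFun z P
  law : ∀ k, HasLaw (z k) (stdComplexGaussian (Fin M)) P
  ne_zero : ∀ k, c k ≠ 0
  eq_smul : ∀ k ω, v k ω = c k • z k ω

section Columns

variable {Ω : Type*} [MeasurableSpace Ω] {P : Measure Ω} {M : ℕ} {κ : Type*}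
  {c : κ → ℂ} {z v : κ → Ω → Fin M → ℂ}

lemma IsGaussianFamily.aemeasurable (h : IsGaussianFamily P c z v) (k : κ) :
    AEMeasurable (v k) P := by
  rw [funext (h.eq_smul k)]
  exact (h.law k).aemeasurable.const_smul (c k)

lemma aemeasurable_colMat [Fintype κ] {ι : Type*} (f : ι → κ) (hv : ∀ k, AEMeasurable (v k) P) :
    AEMeasurable (fun ω => colMat f fun k => v k ω) P := by
  have hm : Measurable fun x : κ → Fin M → ℂ => colMat f x := by
    refine measurable_matrix_iff.2 fun m i => ?_
    simp only [colMat, Matrix.of_apply]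
    fun_prop
  exact hm.comp_aemeasurable (f := fun ω k => v k ω) (aemeasurable_pi_lambda _ hv)

/-- The matrix is a function of the vectors `z j` with `j ≠ k` only. -/
lemma IsGaussianFamily.indepFun_colMat [Fintype κ] [DecidableEq κ] (h : IsGaussianFamily P c z v) {ι : Type*} (f : ι → κ)
    {k : κ} (hk : k ∉ Set.range f) :
    IndepFun (fun ω => colMat f fun k => v k ω) (z k) P := by
  have hne : ∀ i, f i ∈ ({k}ᶜ : Finset κ) := fun i => by
    simpa using fun hi => hk ⟨i, hi⟩
  have hind := h.indep.indepFun_finset₀ ({k}ᶜ : Finset κ) {k} (by simp)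
    fun i => (h.law i).aemeasurable
  have hm1 : Measurable fun x : ({k}ᶜ : Finset κ) → Fin M → ℂ =>
      (Matrix.of fun m i => c (f i) * x ⟨f i, hne i⟩ m : Matrix (Fin M) ι ℂ) := by
    refine measurable_matrix_iff.2 fun m i => ?_
    simp only [Matrix.of_apply]
    fun_prop
  have hm2 : Measurable fun x : ({k} : Finset κ) → Fin M → ℂ => x ⟨k, by simp⟩ := by fun_prop
  have := hind.comp hm1 hm2
  refine this.congr (.of_forall fun ω => ?_) (.of_forall fun ω => rfl)
  ext m i
  simp [colMat, h.eq_smul]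

lemma isUnit_det_gram_colMat {ι : Type*} [Fintype ι] [DecidableEq ι] {f : ι → κ}
    {x : κ → Fin M → ℂ} (hx : LinearIndependent ℂ fun i => x (f i)) :
    IsUnit ((colMat f x)ᴴ * colMat f x).det := by
  rw [isUnit_iff_ne_zero]
  open scoped ComplexOrder in
  exact (Matrix.PosDef.conjTranspose_mul_self _ (Matrix.mulVec_injective_iff.2 hx)).det_pos.ne'

lemma IsGaussianFamily.sqNorm_orthProj_colMat (h : IsGaussianFamily P c z v) {ι : Type*}
    [Fintype ι] [DecidableEq ι] (f : ι → κ) (k : κ) (ω : Ω) :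
    sqNorm (orthProj (colMat f fun k => v k ω) *ᵥ v k ω) =
      ‖c k‖ ^ 2 * sqNorm (orthProj (colMat f fun k => v k ω) *ᵥ z k ω) := by
  rw [h.eq_smul k ω, Matrix.mulVec_smul, sqNorm_smul]

variable [IsProbabilityMeasure P] [Fintype κ] [DecidableEq κ]

/-- At most `M` independent Gaussian vectors in `ℂᴹ` are almost surely linearly independent. -/
lemma IsGaussianFamily.ae_linearIndepOn (h : IsGaussianFamily P c z v) (T : Finset κ)
    (hT : T.card ≤ M) : ∀ᵐ ω ∂P, LinearIndepOn ℂ (fun k => v k ω) (T : Set κ) := by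
  induction T using Finset.induction_on with
  | empty => simp
  | insert a T ha ih =>
    rw [Finset.card_insert_of_notMem ha] at hT
    have ih := ih (by lia)
    have hdet : ∀ᵐ ω ∂P, IsUnit ((colMat (Subtype.val : T → κ) fun k => v k ω)ᴴ *
        colMat (Subtype.val : T → κ) fun k => v k ω).det := by
      filter_upwards [ih] with ω hω
      exact isUnit_det_gram_colMat hω
    -- The new vector avoids the span of the earlier ones because its squared distance to that span
    -- has a Gamma law of shape `M - T.card ≥ 1`, which gives no mass to zero.
    have hlaw := hasLaw_sqNorm_orthProj (aemeasurable_colMat Subtype.val h.aemeasurable)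
      (h.law a) (h.indepFun_colMat (Subtype.val : T → κ) (by simpa using ha)) hdet
      (n := M - T.card) (by rw [Fintype.card_coe]; lia)
    have hpos := (hlaw.ae_iff (measurableSet_setOfPred.1 measurableSet_Ioi)).2
      (ae_pos_sqNormLaw (n := M - T.card) (by lia))
    filter_upwards [ih, hdet, hpos] with ω h1 h2 h3
    rw [Finset.coe_insert]
    refine h1.insert fun hmem => ?_
    have hle : Submodule.span ℂ ((fun k => v k ω) '' (T : Set κ)) ≤
        LinearMap.ker (Matrix.mulVecLin (orthProj (colMat (Subtype.val : T → κ) fun k => v k ω))) := by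
      rw [Submodule.span_le]
      rintro _ ⟨k, hk, rfl⟩
      ext m
      exact congrFun (congrFun (orthProj_mul_self_eq_zero h2) m) ⟨k, hk⟩
    have h4 := hle hmem
    rw [LinearMap.mem_ker, Matrix.mulVecLin_apply] at h4
    simp only [h.eq_smul a, Matrix.mulVec_smul] at h4
    rw [(smul_eq_zero.1 h4).resolve_left (h.ne_zero a)] at h3
    simp [sqNorm] at h3

lemma IsGaussianFamily.ae_isUnit_det (h : IsGaussianFamily P c z v) {ι : Type*} [Fintype ι]
    [DecidableEq ι] {f : ι → κ} (hf : Function.Injective f) (hι : Fintype.card ι ≤ M) :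
    ∀ᵐ ω ∂P, IsUnit ((colMat f fun k => v k ω)ᴴ * colMat f fun k => v k ω).det := by
  have := h.ae_linearIndepOn (Finset.univ.image f)
    (by rwa [Finset.card_image_of_injective _ hf, Finset.card_univ])
  filter_upwards [this] with ω hω
  refine isUnit_det_gram_colMat (f := f) ?_
  have hmem : ∀ i, f i ∈ ((Finset.univ.image f : Finset κ) : Set κ) := by simp
  exact hω.comp (fun i => ⟨f i, hmem i⟩) fun i j hij => hf (by simpa using hij)

lemma IsGaussianFamily.hasLaw_sqNorm_orthProj_colMat (h : IsGaussianFamily P c z v) {ι : Type*}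
    [Fintype ι] [DecidableEq ι] {f : ι → κ} (hf : Function.Injective f) {k : κ}
    (hk : k ∉ Set.range f) {n : ℕ} (hn : n + Fintype.card ι = M) :
    HasLaw (fun ω => sqNorm (orthProj (colMat f fun k => v k ω) *ᵥ z k ω)) (sqNormLaw n) P :=
  hasLaw_sqNorm_orthProj (aemeasurable_colMat f h.aemeasurable) (h.law k)
    (h.indepFun_colMat f hk) (h.ae_isUnit_det hf (by lia)) hn

/-! ### Moments of the partial zero-forcing vectors -/

section Moments

variable {ι : Type*} [Fintype ι] [DecidableEq ι] {f : ι → κ} {n : ℕ}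

lemma IsGaussianFamily.memLp_sqNorm_orthProj (h : IsGaussianFamily P c z v)
    (hf : Function.Injective f) {k : κ} (hk : k ∉ Set.range f) (hn : n + Fintype.card ι = M) :
    MemLp (fun ω => sqNorm (orthProj (colMat f fun k => v k ω) *ᵥ v k ω)) 2 P := by
  simp_rw [h.sqNorm_orthProj_colMat]
  have hlaw := h.hasLaw_sqNorm_orthProj_colMat hf hk hn
  refine MemLp.const_mul ?_ _
  have h2 := memLp_two_sqNormLaw n
  rw [← hlaw.map_eq, memLp_map_measure_iff (by fun_prop) hlaw.aemeasurable] at h2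
  exact h2

lemma IsGaussianFamily.integral_sqNorm_orthProj (h : IsGaussianFamily P c z v)
    (hf : Function.Injective f) {k : κ} (hk : k ∉ Set.range f) (hn : n + Fintype.card ι = M) :
    ∫ ω, sqNorm (orthProj (colMat f fun k => v k ω) *ᵥ v k ω) ∂P = ‖c k‖ ^ 2 * n := by
  simp_rw [h.sqNorm_orthProj_colMat]
  have hlaw := h.hasLaw_sqNorm_orthProj_colMat hf hk hn
  rw [integral_const_mul, hlaw.integral_eq, integral_sqNormLaw]

lemma IsGaussianFamily.integral_sqNorm_sq_orthProj (h : IsGaussianFamily P c z v)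
    (hf : Function.Injective f) {k : κ} (hk : k ∉ Set.range f) (hn : n + Fintype.card ι = M) :
    ∫ ω, sqNorm (orthProj (colMat f fun k => v k ω) *ᵥ v k ω) ^ 2 ∂P =
      ‖c k‖ ^ 4 * (n * (n + 1)) := by
  simp_rw [h.sqNorm_orthProj_colMat, mul_pow]
  have hlaw := h.hasLaw_sqNorm_orthProj_colMat hf hk hn
  have := hlaw.integral_comp (f := fun x => x ^ 2) (by fun_prop)
  rw [integral_sq_sqNormLaw, Function.comp_def] at this
  rw [integral_const_mul, this]
  ring

lemma IsGaussianFamily.sqNorm_pinv_ae_eq (h : IsGaussianFamily P c z v)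
    (hf : Function.Injective f) (i : ι) (hι : Fintype.card ι ≤ M) :
    (fun ω => sqNorm (((colMat f fun k => v k ω) *
      ((colMat f fun k => v k ω)ᴴ * colMat f fun k => v k ω)⁻¹) *ᵥ Pi.single i 1)) =ᵐ[P]
    fun ω => (‖c (f i)‖ ^ 2)⁻¹ * (sqNorm (orthProj (colMat (fun j : {j // j ≠ i} => f j)
      fun k => v k ω) *ᵥ z (f i) ω))⁻¹ := by
  have hf' : Function.Injective fun j : {j // j ≠ i} => f j := hf.comp Subtype.val_injective
  have hcard : Fintype.card {j // j ≠ i} ≤ M := (Fintype.card_subtype_le _).trans hι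
  filter_upwards [h.ae_isUnit_det hf hι, h.ae_isUnit_det hf' hcard] with ω h1 h2
  rw [← mul_inv, ← h.sqNorm_orthProj_colMat]
  exact sqNorm_pinv_mulVec_single i h1 h2

/-- Only `card ι - 1` columns are projected off, so the remaining dimension is `n + 1`. For `n > 0`
this is at least `2`, which is what a finite inverse moment requires. -/
lemma IsGaussianFamily.hasLaw_sqNorm_orthProj_others (h : IsGaussianFamily P c z v)
    (hf : Function.Injective f) (i : ι) (hn : n + Fintype.card ι = M) :
    HasLaw (fun ω => sqNorm (orthProj (colMat (fun j : {j // j ≠ i} => f j)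
      fun k => v k ω) *ᵥ z (f i) ω)) (sqNormLaw (n + 1)) P := by
  refine h.hasLaw_sqNorm_orthProj_colMat (hf.comp Subtype.val_injective) ?_ ?_
  · rintro ⟨j, hj⟩
    exact j.2 (hf hj)
  · have hpos : 0 < Fintype.card ι := Fintype.card_pos_iff.2 ⟨i⟩
    rw [Fintype.card_subtype_compl, Fintype.card_subtype_eq]
    lia

lemma IsGaussianFamily.integrable_sqNorm_pinv (h : IsGaussianFamily P c z v)
    (hf : Function.Injective f) (i : ι) (hn : n + Fintype.card ι = M) (hn0 : 0 < n) :
    Integrable (fun ω => sqNorm (((colMat f fun k => v k ω) *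
      ((colMat f fun k => v k ω)ᴴ * colMat f fun k => v k ω)⁻¹) *ᵥ Pi.single i 1)) P := by
  refine Integrable.congr ?_ (h.sqNorm_pinv_ae_eq hf i (by lia)).symm
  refine Integrable.const_mul ?_ _
  have hlaw := h.hasLaw_sqNorm_orthProj_others hf i hn
  have h2 := integrable_inv_sqNormLaw (n := n + 1) (by lia)
  rw [← hlaw.map_eq, integrable_map_measure (by fun_prop) hlaw.aemeasurable] at h2
  exact h2

lemma IsGaussianFamily.integral_sqNorm_pinv (h : IsGaussianFamily P c z v)
    (hf : Function.Injective f) (i : ι) (hn : n + Fintype.card ι = M) (hn0 : 0 < n) :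
    ∫ ω, sqNorm (((colMat f fun k => v k ω) *
      ((colMat f fun k => v k ω)ᴴ * colMat f fun k => v k ω)⁻¹) *ᵥ Pi.single i 1) ∂P =
      (‖c (f i)‖ ^ 2 * n)⁻¹ := by
  have hlaw := h.hasLaw_sqNorm_orthProj_others hf i hn
  have h2 := hlaw.integral_comp (f := fun x => x⁻¹) (by fun_prop)
  rw [integral_inv_sqNormLaw (by lia), Function.comp_def] at h2
  rw [integral_congr_ae (h.sqNorm_pinv_ae_eq hf i (by lia)), integral_const_mul, h2, mul_inv]
  push_cast
  rw [add_sub_cancel_right]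

end Moments

end Columns

open scoped ComplexConjugate

/-! ### Second moments of complex random variables -/

section SecondMoments

variable {Ω : Type*} [MeasurableSpace Ω] {P : Measure Ω}

lemma integrable_mul_conj {X Y : Ω → ℂ} (hX : MemLp X 2 P) (hY : MemLp Y 2 P) :
    Integrable (fun ω => X ω * conj (Y ω)) P :=
  hX.integrable_mul hY.star

lemma ofReal_integral_norm_sq (X : Ω → ℂ) :
    ((∫ ω, ‖X ω‖ ^ 2 ∂P : ℝ) : ℂ) = ∫ ω, X ω * conj (X ω) ∂P := by
  rw [← integral_complex_ofReal]
  refine integral_congr_ae (.of_forall fun ω => ?_)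
  simp [Complex.mul_conj']

lemma integral_norm_sq_sum {ι : Type*} (s : Finset ι) {X : ι → Ω → ℂ}
    (hX : ∀ i, MemLp (X i) 2 P) :
    ((∫ ω, ‖∑ i ∈ s, X i ω‖ ^ 2 ∂P : ℝ) : ℂ) =
      ∑ i ∈ s, ∑ j ∈ s, ∫ ω, X i ω * conj (X j ω) ∂P := by
  rw [ofReal_integral_norm_sq]
  simp_rw [map_sum, Finset.sum_mul_sum]
  rw [integral_finsetSum _ fun i _ => integrable_finsetSum _ fun j _ =>
    integrable_mul_conj (hX i) (hX j)]
  refine Finset.sum_congr rfl fun i _ => ?_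
  rw [integral_finsetSum _ fun j _ => integrable_mul_conj (hX i) (hX j)]

lemma memLp_two_mul_of_indepFun {X Y : Ω → ℂ} (hX : MemLp X 2 P) (hY : MemLp Y 2 P)
    (h : IndepFun X Y P) : MemLp (fun ω => X ω * Y ω) 2 P := by
  have hm : AEStronglyMeasurable (fun ω => X ω * Y ω) P := hX.1.mul hY.1
  rw [memLp_two_iff_integrable_sq_norm hm]
  have h1 := (memLp_two_iff_integrable_sq_norm hX.1).1 hX
  have h2 := (memLp_two_iff_integrable_sq_norm hY.1).1 hY
  have h3 : IndepFun (fun ω => ‖X ω‖ ^ 2) (fun ω => ‖Y ω‖ ^ 2) P :=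
    h.comp (φ := fun x : ℂ => ‖x‖ ^ 2) (ψ := fun x : ℂ => ‖x‖ ^ 2) (by fun_prop) (by fun_prop)
  refine (h3.integrable_mul h1 h2).congr (.of_forall fun ω => ?_)
  simp [mul_pow]

/-- The second moment of a sum of independent square integrable complex random variables. -/
lemma integral_norm_sq_sum_of_indepFun {ι : Type*} [Fintype ι] {X : ι → Ω → ℂ}
    (hX : ∀ i, MemLp (X i) 2 P) (hind : ∀ i j, i ≠ j → IndepFun (X i) (X j) P) :
    ∫ ω, ‖∑ i, X i ω‖ ^ 2 ∂P = ‖∑ i, ∫ ω, X i ω ∂P‖ ^ 2 +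
      ∑ i, (∫ ω, ‖X i ω‖ ^ 2 ∂P - ‖∫ ω, X i ω ∂P‖ ^ 2) := by
  classical
  -- Independence makes the matrix of mixed moments a rank-one matrix of means plus a diagonal of
  -- variances.
  have hij : ∀ i j, ∫ ω, X i ω * conj (X j ω) ∂P = (∫ ω, X i ω ∂P) * conj (∫ ω, X j ω ∂P) +
      if i = j then ((∫ ω, ‖X i ω‖ ^ 2 ∂P - ‖∫ ω, X i ω ∂P‖ ^ 2 : ℝ) : ℂ) else 0 := by
    intro i j
    split_ifs with h
    · subst h
      rw [Complex.ofReal_sub, ofReal_integral_norm_sq, Complex.mul_conj']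
      push_cast
      ring
    · have h' : IndepFun (X i) (fun ω => conj (X j ω)) P :=
        (hind i j h).comp measurable_id (ψ := fun x : ℂ => conj x) (by fun_prop)
      rw [h'.integral_fun_mul_eq_mul_integral (hX i).1 (hX j).star.1, integral_conj, add_zero]
  have key := integral_norm_sq_sum Finset.univ hX
  simp_rw [hij, Finset.sum_add_distrib, ← Finset.sum_mul_sum, ← map_sum, Complex.mul_conj',
    Finset.sum_ite_eq, Finset.mem_univ, if_true] at key
  exact_mod_cast key

end SecondMoments

/-! ### Inner products with an independent Gaussian vector -/

section Isotropic

variable {Ω : Type*} [MeasurableSpace Ω] {P : Measure Ω} {M : ℕ}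

lemma hasLaw_apply_of_stdComplexGaussian {ι : Type*} [Fintype ι] {e : Ω → ι → ℂ}
    (he : HasLaw e (stdComplexGaussian ι) P) (i : ι) :
    HasLaw (fun ω => e ω i) (complexGaussian 1) P :=
  (measurePreserving_eval (fun _ : ι => complexGaussian 1) i).fun_comp_hasLaw he

lemma iIndepFun_of_stdComplexGaussian [IsProbabilityMeasure P] {ι : Type*} [Fintype ι] {e : Ω → ι → ℂ}
    (he : HasLaw e (stdComplexGaussian ι) P) : iIndepFun (fun i ω => e ω i) P := by
  rw [iIndepFun_iff_map_fun_eq_pi_map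
    fun i => (hasLaw_apply_of_stdComplexGaussian he i).aemeasurable]
  simp_rw [(hasLaw_apply_of_stdComplexGaussian he _).map_eq]
  exact he.map_eq

lemma hasLaw_complexGaussian_memLp {X : Ω → ℂ} (hX : HasLaw X (complexGaussian 1) P) :
    MemLp X 2 P := by
  have h := memLp_two_complexGaussian_one
  rw [← hX.map_eq, memLp_map_measure_iff (by fun_prop) hX.aemeasurable] at h
  exact h

lemma integral_mul_conj_stdComplexGaussian [IsProbabilityMeasure P] {e : Ω → Fin M → ℂ}
    (he : HasLaw e (stdComplexGaussian (Fin M)) P) (i j : Fin M) :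
    ∫ ω, e ω i * conj (e ω j) ∂P = if i = j then 1 else 0 := by
  have hL := fun i => hasLaw_apply_of_stdComplexGaussian he i
  split_ifs with h
  · subst h
    rw [← ofReal_integral_norm_sq]
    have := (hL i).integral_comp (f := fun x : ℂ => ‖x‖ ^ 2) (by fun_prop)
    rw [integral_norm_sq_complexGaussian_one, Function.comp_def] at this
    rw [this, Complex.ofReal_one]
  · have h' : IndepFun (fun ω => e ω i) (fun ω => conj (e ω j)) P :=
      ((iIndepFun_of_stdComplexGaussian he).indepFun h).comp measurable_id
        (ψ := fun x : ℂ => conj x) (by fun_prop)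
    rw [h'.integral_fun_mul_eq_mul_integral (hasLaw_complexGaussian_memLp (hL i)).1
      (hasLaw_complexGaussian_memLp (hL j)).star.1, (hL i).integral_eq,
      integral_complexGaussian_one_eq_zero, zero_mul]

variable {e W : Ω → Fin M → ℂ} {A : Ω → ℂ}

lemma memLp_two_apply_of_integrable_sqNorm (hW : AEMeasurable W P)
    (hW2 : Integrable (fun ω => sqNorm (W ω)) P) (m : Fin M) : MemLp (fun ω => W ω m) 2 P := by
  have hm : AEStronglyMeasurable (fun ω => W ω m) P :=
    ((measurable_pi_apply m).comp_aemeasurable hW).aestronglyMeasurable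
  rw [memLp_two_iff_integrable_sq_norm hm]
  refine hW2.mono' (hm.norm.pow 2) (.of_forall fun ω => ?_)
  rw [Real.norm_of_nonneg (by positivity)]
  exact Finset.single_le_sum (f := fun m => ‖W ω m‖ ^ 2) (fun i _ => by positivity)
    (Finset.mem_univ m)

/-- Mean and second moment of `A + b ⟨e, W⟩` for a standard complex Gaussian vector `e` that is
independent of `(A, W)`. -/
lemma moments_add_inner_gaussian [IsProbabilityMeasure P]
    (he : HasLaw e (stdComplexGaussian (Fin M)) P)
    (hind : IndepFun e (fun ω => (A ω, W ω)) P) (hA : MemLp A 2 P) (hW : AEMeasurable W P)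
    (hW2 : Integrable (fun ω => sqNorm (W ω)) P) (b : ℝ) :
    MemLp (fun ω => A ω + b * (star (e ω) ⬝ᵥ W ω)) 2 P ∧
    ∫ ω, (A ω + b * (star (e ω) ⬝ᵥ W ω)) ∂P = ∫ ω, A ω ∂P ∧
    ∫ ω, ‖A ω + b * (star (e ω) ⬝ᵥ W ω)‖ ^ 2 ∂P =
      ∫ ω, ‖A ω‖ ^ 2 ∂P + b ^ 2 * ∫ ω, sqNorm (W ω) ∂P := by
  have hL := fun m => hasLaw_apply_of_stdComplexGaussian he m
  have hem := fun m => hasLaw_complexGaussian_memLp (hL m)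
  have hWm := memLp_two_apply_of_integrable_sqNorm hW hW2
  let T : Fin M → Ω → ℂ := fun m ω => conj (e ω m) * (b * W ω m)
  have hTind : ∀ m, IndepFun (fun ω => conj (e ω m)) (fun ω => b * W ω m) P := fun m =>
    hind.comp (φ := fun x : Fin M → ℂ => conj (x m))
      (ψ := fun q : ℂ × (Fin M → ℂ) => (b : ℂ) * q.2 m) (by fun_prop) (by fun_prop)
  have hT : ∀ m, MemLp (T m) 2 P := fun m =>
    memLp_two_mul_of_indepFun (hem m).star ((hWm m).const_mul _) (hTind m)
  have hmean : ∀ m, ∫ ω, conj (e ω m) ∂P = 0 := fun m => by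
    rw [integral_conj, (hL m).integral_eq, integral_complexGaussian_one_eq_zero, map_zero]
  have hT0 : ∀ m, ∫ ω, T m ω ∂P = 0 := fun m => by
    rw [(hTind m).integral_fun_mul_eq_mul_integral (hem m).star.1 ((hWm m).const_mul _).1,
      hmean, zero_mul]
  -- Here `A` and `W` may depend on each other; independence of `e` from the pair and `E e = 0`
  -- suffice.
  have hAT : ∀ m, ∫ ω, T m ω * conj (A ω) ∂P = 0 := by
    intro m
    have hi : IndepFun (fun ω => conj (e ω m)) (fun ω => b * W ω m * conj (A ω)) P :=
      hind.comp (φ := fun x : Fin M → ℂ => conj (x m))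
        (ψ := fun q : ℂ × (Fin M → ℂ) => (b : ℂ) * q.2 m * conj q.1) (by fun_prop) (by fun_prop)
    have := hi.integral_fun_mul_eq_mul_integral (hem m).star.1
      (((hWm m).const_mul _).1.mul hA.star.1)
    rw [hmean, zero_mul] at this
    rw [← this]
    refine integral_congr_ae (.of_forall fun ω => ?_)
    simp only [T]
    ring
  have hTA : ∀ m, ∫ ω, A ω * conj (T m ω) ∂P = 0 := by
    intro m
    have := congrArg conj (hAT m)
    rw [← integral_conj, map_zero] at this
    rw [← this]
    refine integral_congr_ae (.of_forall fun ω => ?_)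
    simp only [map_mul, Complex.conj_conj]
    ring
  have hTT : ∀ m m', ∫ ω, T m ω * conj (T m' ω) ∂P =
      if m = m' then ((b ^ 2 * ∫ ω, ‖W ω m‖ ^ 2 ∂P : ℝ) : ℂ) else 0 := by
    intro m m'
    have hi : IndepFun (fun ω => e ω m' * conj (e ω m))
        (fun ω => b * W ω m * conj (b * W ω m')) P :=
      hind.comp (φ := fun x : Fin M → ℂ => x m' * conj (x m))
        (ψ := fun q : ℂ × (Fin M → ℂ) => (b : ℂ) * q.2 m * conj ((b : ℂ) * q.2 m'))
        (by fun_prop) (by fun_prop)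
    have h1 := hi.integral_fun_mul_eq_mul_integral ((hem m').1.mul (hem m).star.1)
      (((hWm m).const_mul _).1.mul ((hWm m').const_mul _).star.1)
    rw [integral_mul_conj_stdComplexGaussian he] at h1
    have h2 : ∫ ω, T m ω * conj (T m' ω) ∂P =
        ∫ ω, e ω m' * conj (e ω m) * (b * W ω m * conj (b * W ω m')) ∂P := by
      refine integral_congr_ae (.of_forall fun ω => ?_)
      simp only [T, map_mul, Complex.conj_conj]
      ring
    rw [h2, h1]
    by_cases h : m = m'
    · subst h
      rw [if_pos rfl, if_pos rfl, one_mul, ← ofReal_integral_norm_sq]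
      simp [mul_pow, integral_const_mul]
    · rw [if_neg h, if_neg (Ne.symm h), zero_mul]
  have hsum : ∀ ω, A ω + b * (star (e ω) ⬝ᵥ W ω) = A ω + ∑ m, T m ω := by
    intro ω
    simp only [dotProduct, T, Finset.mul_sum, Pi.star_apply, RCLike.star_def]
    congr 1
    exact Finset.sum_congr rfl fun m _ => by ring
  simp_rw [hsum]
  -- Indexing by `Option` treats `A` as one more summand of an orthogonal family.
  let X : Option (Fin M) → Ω → ℂ := fun o => o.elim A T
  have hX : ∀ o, MemLp (X o) 2 P := by
    rintro (_ | m)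
    exacts [hA, hT m]
  have hXs : ∀ ω, ∑ o, X o ω = A ω + ∑ m, T m ω := fun ω => by
    rw [Fintype.sum_option]; rfl
  simp_rw [← hXs]
  refine ⟨memLp_finsetSum _ fun o _ => hX o, ?_, ?_⟩
  · rw [integral_finsetSum _ fun o _ => (hX o).integrable (by norm_num), Fintype.sum_option]
    simp only [X, Option.elim, hT0, Finset.sum_const_zero, add_zero]
  · have key := integral_norm_sq_sum Finset.univ hX
    simp only [Fintype.sum_option, X, Option.elim, hTA, hAT, hTT, Finset.sum_const_zero, add_zero,
      zero_add, ← ofReal_integral_norm_sq, Finset.sum_ite_eq, Finset.mem_univ, if_true] at key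
    simp only [Fintype.sum_option, X, Option.elim]
    have hs : ∫ ω, sqNorm (W ω) ∂P = ∑ m, ∫ ω, ‖W ω m‖ ^ 2 ∂P :=
      integral_finsetSum _ fun m _ => (memLp_two_iff_integrable_sq_norm (hWm m).1).1 (hWm m)
    rw [hs, Finset.mul_sum]
    exact_mod_cast key

end Isotropic

/-! ### The precoder of one access point -/

section Precoder

variable {M : ℕ} {κ : Type*} [DecidableEq κ]

/-- The unnormalized precoder towards user `t` for the channel estimates `x`, with `S` the strong
users. -/
def ppzfVec (S : Finset κ) (t : κ) (x : κ → Fin M → ℂ) : Fin M → ℂ :=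
  if t ∈ S then
    (colMat (Subtype.val : S → κ) x * ((colMat (Subtype.val : S → κ) x)ᴴ *
      colMat (Subtype.val : S → κ) x)⁻¹) *ᵥ fun i => if (i : κ) = t then 1 else 0
  else orthProj (colMat (Subtype.val : S → κ) x) *ᵥ x t

lemma ppzfVec_of_mem {S : Finset κ} {t : κ} (ht : t ∈ S) (x : κ → Fin M → ℂ) :
    ppzfVec S t x = (colMat (Subtype.val : S → κ) x * ((colMat (Subtype.val : S → κ) x)ᴴ *
      colMat (Subtype.val : S → κ) x)⁻¹) *ᵥ Pi.single ⟨t, ht⟩ 1 := by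
  rw [ppzfVec, if_pos ht]
  congr 1
  ext i
  simp [Pi.single_apply, Subtype.ext_iff]

lemma ppzfVec_of_notMem {S : Finset κ} {t : κ} (ht : t ∉ S) (x : κ → Fin M → ℂ) :
    ppzfVec S t x = orthProj (colMat (Subtype.val : S → κ) x) *ᵥ x t := by
  rw [ppzfVec, if_neg ht]

/-- The precoder towards `t` ignores the estimate of any other weak user; this is the source of its
independence from that estimate. -/
lemma ppzfVec_congr {S : Finset κ} {t o : κ} (ho : o ∉ S) (hto : t ≠ o) {x y : κ → Fin M → ℂ}
    (hxy : ∀ k, k ≠ o → x k = y k) : ppzfVec S t x = ppzfVec S t y := by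
  have h : colMat (Subtype.val : S → κ) x = colMat (Subtype.val : S → κ) y := by
    ext m i
    exact congrFun (hxy i fun hi => ho (hi ▸ i.2)) m
  rw [ppzfVec, ppzfVec, h, hxy t hto]

lemma measurable_ppzfVec [Fintype κ] (S : Finset κ) (t : κ) :
    Measurable fun x : κ → Fin M → ℂ => ppzfVec S t x := by
  have hm : Measurable fun x : κ → Fin M → ℂ => colMat (Subtype.val : S → κ) x := by
    refine measurable_matrix_iff.2 fun m i => ?_
    simp only [colMat, Matrix.of_apply]
    fun_prop
  by_cases ht : t ∈ S
  · simp only [ppzfVec, if_pos ht]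
    refine measurable_pi_lambda _ fun i => ?_
    simp only [Matrix.mulVec, dotProduct]
    refine Finset.measurable_sum _ fun j _ => Measurable.mul ?_ measurable_const
    exact measurable_matrix_iff.1 (measurable_pinv.comp hm) i j
  · simp only [ppzfVec, if_neg ht]
    exact measurable_orthProj_mulVec hm (measurable_pi_apply t)

/-- Zero forcing: the pseudoinverse is biorthogonal to the strong columns, and the projection for
weak users annihilates them. -/
lemma star_dotProduct_ppzfVec_of_mem {S : Finset κ} {o : κ} (ho : o ∈ S) (t : κ)
    {x : κ → Fin M → ℂ} (hx : IsUnit ((colMat (Subtype.val : S → κ) x)ᴴ *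
      colMat (Subtype.val : S → κ) x).det) :
    star (x o) ⬝ᵥ ppzfVec S t x = if t = o then 1 else 0 := by
  have h0 : star (x o) ⬝ᵥ ppzfVec S t x =
      ((colMat (Subtype.val : S → κ) x)ᴴ *ᵥ ppzfVec S t x) ⟨o, ho⟩ := rfl
  rw [h0]
  by_cases ht : t ∈ S
  · rw [ppzfVec_of_mem ht, Matrix.mulVec_mulVec, ← Matrix.mul_assoc, Matrix.mul_nonsing_inv _ hx,
      Matrix.one_mulVec]
    simp [Pi.single_apply, eq_comm]
  · rw [ppzfVec_of_notMem ht, Matrix.mulVec_mulVec, conjTranspose_mul_orthProj hx,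
      Matrix.zero_mulVec, if_neg fun h : t = o => ht (h ▸ ho)]
    rfl

lemma star_dotProduct_ppzfVec_self_of_notMem {S : Finset κ} {o : κ} (ho : o ∉ S)
    {x : κ → Fin M → ℂ} (hx : IsUnit ((colMat (Subtype.val : S → κ) x)ᴴ *
      colMat (Subtype.val : S → κ) x).det) :
    star (x o) ⬝ᵥ ppzfVec S o x = sqNorm (ppzfVec S o x) := by
  rw [ofReal_sqNorm, ppzfVec_of_notMem ho, star_dotProduct_orthProj_mulVec hx]

end Precoder

/-! ### Power and channel inner products of the normalized precoder -/

section AccessPoint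

variable {Ω : Type*} [MeasurableSpace Ω] {P : Measure Ω} {M : ℕ}

lemma sqNorm_normalize (V : Ω → Fin M → ℂ) (ω : Ω) :
    sqNorm (normalize P V ω) = (∫ ω', sqNorm (V ω') ∂P)⁻¹ * sqNorm (V ω) := by
  have h0 : 0 ≤ ∫ ω', sqNorm (V ω') ∂P := integral_nonneg fun ω => sqNorm_nonneg _
  rw [normalize, sqNorm_smul, Complex.norm_real, Real.norm_eq_abs, sq_abs, inv_pow,
    Real.sq_sqrt h0]

lemma integral_sqNorm_normalize {V : Ω → Fin M → ℂ} (hV : 0 < ∫ ω, sqNorm (V ω) ∂P) :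
    ∫ ω, sqNorm (normalize P V ω) ∂P = 1 := by
  simp_rw [sqNorm_normalize]
  rw [integral_const_mul, inv_mul_cancel₀ hV.ne']

lemma integrable_sqNorm_normalize {V : Ω → Fin M → ℂ}
    (hV : Integrable (fun ω => sqNorm (V ω)) P) :
    Integrable (fun ω => sqNorm (normalize P V ω)) P := by
  simp_rw [sqNorm_normalize]
  exact hV.const_mul _

lemma aemeasurable_normalize {V : Ω → Fin M → ℂ} (hV : AEMeasurable V P) :
    AEMeasurable (normalize P V) P :=
  (measurable_const_smul _).comp_aemeasurable hV

variable {κ : Type*} [Fintype κ] [DecidableEq κ] {c : κ → ℝ} {z v : κ → Ω → Fin M → ℂ}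
  {S : Finset κ} {n : ℕ}

lemma IsGaussianFamily.aemeasurable_ppzfVec (h : IsGaussianFamily P (fun k => (c k : ℂ)) z v)
    (t : κ) : AEMeasurable (fun ω => ppzfVec S t fun k => v k ω) P :=
  (measurable_ppzfVec S t).comp_aemeasurable (f := fun ω k => v k ω)
    (aemeasurable_pi_lambda _ h.aemeasurable)

variable [IsProbabilityMeasure P]

lemma IsGaussianFamily.integrable_sqNorm_ppzfVec
    (h : IsGaussianFamily P (fun k => (c k : ℂ)) z v) (hn : n + S.card = M) (hn0 : 0 < n) (t : κ) :
    Integrable (fun ω => sqNorm (ppzfVec S t fun k => v k ω)) P := by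
  have hn' : n + Fintype.card S = M := by rwa [Fintype.card_coe]
  by_cases ht : t ∈ S
  · simp_rw [ppzfVec_of_mem ht]
    exact h.integrable_sqNorm_pinv Subtype.val_injective ⟨t, ht⟩ hn' hn0
  · simp_rw [ppzfVec_of_notMem ht]
    exact (h.memLp_sqNorm_orthProj Subtype.val_injective (by simpa using ht) hn').integrable
      (by norm_num)

lemma IsGaussianFamily.integral_sqNorm_ppzfVec
    (h : IsGaussianFamily P (fun k => (c k : ℂ)) z v) (hn : n + S.card = M) (hn0 : 0 < n) (t : κ) :
    ∫ ω, sqNorm (ppzfVec S t fun k => v k ω) ∂P =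
      if t ∈ S then (c t ^ 2 * n)⁻¹ else c t ^ 2 * n := by
  have hn' : n + Fintype.card S = M := by rwa [Fintype.card_coe]
  split_ifs with ht
  · simp_rw [ppzfVec_of_mem ht]
    rw [h.integral_sqNorm_pinv Subtype.val_injective ⟨t, ht⟩ hn' hn0, Complex.norm_real,
      Real.norm_eq_abs, sq_abs]
  · simp_rw [ppzfVec_of_notMem ht]
    rw [h.integral_sqNorm_orthProj Subtype.val_injective (by simpa using ht) hn',
      Complex.norm_real, Real.norm_eq_abs, sq_abs]

lemma IsGaussianFamily.integral_sqNorm_ppzfVec_pos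
    (h : IsGaussianFamily P (fun k => (c k : ℂ)) z v) (hn : n + S.card = M) (hn0 : 0 < n) (t : κ) :
    0 < ∫ ω, sqNorm (ppzfVec S t fun k => v k ω) ∂P := by
  have hc : c t ≠ 0 := by exact_mod_cast h.ne_zero t
  rw [h.integral_sqNorm_ppzfVec hn hn0]
  split_ifs <;> positivity

/-- Mean and second moment of `⟨z o, w⟩` for the normalized precoder `w` towards user `t`. -/
lemma IsGaussianFamily.moments_inner_precoder
    (h : IsGaussianFamily P (fun k => (c k : ℂ)) z v) (hc : ∀ k, 0 < c k) (hn : n + S.card = M)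
    (hn0 : 0 < n) (o t : κ) :
    MemLp (fun ω => star (z o ω) ⬝ᵥ normalize P (fun ω => ppzfVec S t fun k => v k ω) ω) 2 P ∧
    ∫ ω, star (z o ω) ⬝ᵥ normalize P (fun ω => ppzfVec S t fun k => v k ω) ω ∂P =
      ((if t = o then √n else 0 : ℝ) : ℂ) ∧
    ∫ ω, ‖star (z o ω) ⬝ᵥ normalize P (fun ω => ppzfVec S t fun k => v k ω) ω‖ ^ 2 ∂P =
      (if t = o then (n : ℝ) else 0) + if o ∈ S then 0 else 1 := by
  set V : Ω → Fin M → ℂ := fun ω => ppzfVec S t fun k => v k ω with hV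
  have hn' : n + Fintype.card S = M := by rwa [Fintype.card_coe]
  have hVpos := h.integral_sqNorm_ppzfVec_pos hn hn0 t
  have hVint := h.integrable_sqNorm_ppzfVec hn hn0 t
  have hnpos : (0 : ℝ) < n := by exact_mod_cast hn0
  have hco : (c o : ℂ) ≠ 0 := h.ne_zero o
  have hdet := h.ae_isUnit_det (f := (Subtype.val : S → κ)) Subtype.val_injective (by lia)
  have hval := h.integral_sqNorm_ppzfVec hn hn0 t
  have hz : ∀ ω, star (z o ω) ⬝ᵥ normalize P V ω =
      ((c o)⁻¹ * (√(∫ ω', sqNorm (V ω') ∂P))⁻¹ : ℝ) * (star (v o ω) ⬝ᵥ V ω) := by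
    intro ω
    rw [normalize, h.eq_smul o ω, dotProduct_smul, star_smul, smul_dotProduct]
    simp only [smul_eq_mul, RCLike.star_def, Complex.conj_ofReal]
    push_cast
    field_simp
  by_cases ho : o ∈ S
  · have hae : (fun ω => star (z o ω) ⬝ᵥ normalize P V ω) =ᵐ[P]
        fun _ => ((if t = o then √n else 0 : ℝ) : ℂ) := by
      filter_upwards [hdet] with ω hω
      rw [hz, hV]
      simp only
      rw [star_dotProduct_ppzfVec_of_mem ho t (x := fun k => v k ω) hω]
      split_ifs with hto
      · subst hto
        -- The mean power is `1 / (c² n)`, so normalization multiplies by `c √n`, and `c` cancels.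
        rw [hval, if_pos ho, Real.sqrt_inv, inv_inv, Real.sqrt_mul (by positivity),
          Real.sqrt_sq (hc t).le, inv_mul_cancel_left₀ (hc t).ne', mul_one]
      · simp
    refine ⟨(memLp_congr_ae hae).2 (memLp_const _), ?_, ?_⟩
    · rw [integral_congr_ae hae]
      simp
    · have : (fun ω => ‖star (z o ω) ⬝ᵥ normalize P V ω‖ ^ 2) =ᵐ[P]
          fun _ => ‖((if t = o then √n else 0 : ℝ) : ℂ)‖ ^ 2 := by
        filter_upwards [hae] with ω hω
        rw [hω]
      rw [integral_congr_ae this, if_pos ho]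
      split_ifs <;> simp
  · by_cases hto : t = o
    · subst hto
      rw [if_neg ho] at hval
      -- The squared norm of `V` is `c²` times a Gamma variable `G` of shape `n`, so the inner
      -- product is `G / √n`, with mean `√n` and second moment `n (n + 1) / n = n + 1`.
      have hae : (fun ω => star (z t ω) ⬝ᵥ normalize P V ω) =ᵐ[P]
          fun ω => (((c t ^ 2 * √n)⁻¹ * sqNorm (V ω) : ℝ) : ℂ) := by
        filter_upwards [hdet] with ω hω
        rw [hz, hV]
        simp only
        rw [star_dotProduct_ppzfVec_self_of_notMem ho (x := fun k => v k ω) hω, hval,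
          Real.sqrt_mul (by positivity), Real.sqrt_sq (hc t).le]
        push_cast
        have : (√n : ℂ) ≠ 0 := by exact_mod_cast (Real.sqrt_pos.2 hnpos).ne'
        field_simp
      have hVeq : V = fun ω => orthProj (colMat (Subtype.val : S → κ) fun k => v k ω) *ᵥ v t ω := by
        ext1 ω
        rw [hV]
        exact ppzfVec_of_notMem ho _
      have h2 : MemLp (fun ω => sqNorm (V ω)) 2 P := by
        rw [hVeq]
        exact h.memLp_sqNorm_orthProj Subtype.val_injective (by simpa using ho) hn'
      have h4 : ∫ ω, sqNorm (V ω) ^ 2 ∂P = c t ^ 4 * (n * (n + 1)) := by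
        rw [hVeq]
        simp only
        rw [h.integral_sqNorm_sq_orthProj Subtype.val_injective (by simpa using ho) hn',
          Complex.norm_real, Real.norm_of_nonneg (hc t).le]
      have hs : √(n : ℝ) ^ 2 = n := Real.sq_sqrt hnpos.le
      have hsp : 0 < √(n : ℝ) := Real.sqrt_pos.2 hnpos
      have hct := hc t
      refine ⟨(memLp_congr_ae hae).2 (h2.const_mul _).ofReal, ?_, ?_⟩
      · rw [integral_congr_ae hae, integral_complex_ofReal, integral_const_mul, if_pos rfl, hval]
        congr 1
        field_simp
        exact hs.symm
      · have : (fun ω => ‖star (z t ω) ⬝ᵥ normalize P V ω‖ ^ 2) =ᵐ[P]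
            fun ω => ((c t ^ 2 * √n)⁻¹) ^ 2 * sqNorm (V ω) ^ 2 := by
          filter_upwards [hae] with ω hω
          rw [hω, Complex.norm_real, Real.norm_eq_abs, sq_abs, mul_pow]
        rw [integral_congr_ae this, integral_const_mul, h4, if_pos rfl, if_neg ho, inv_pow,
          mul_pow, hs]
        field_simp
    · rw [if_neg hto, if_neg hto, if_neg ho]
      -- Rebuilds the estimates from the vectors other than `z o`. The value `0` put at `o` is
      -- immaterial, as the precoder does not look there.
      let ext0 : (({o}ᶜ : Finset κ) → Fin M → ℂ) → κ → Fin M → ℂ := fun x k =>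
        if hk : k = o then 0 else (c k : ℂ) • x ⟨k, by simpa using hk⟩
      have hext : Measurable ext0 := by
        refine measurable_pi_lambda _ fun k => ?_
        by_cases hk : k = o
        · simp only [ext0, hk, dite_true]
          exact measurable_const
        · simp only [ext0, hk, dite_false]
          fun_prop
      have hVe : ∀ ω, V ω = ppzfVec S t (ext0 fun k => z k ω) := by
        intro ω
        refine ppzfVec_congr ho hto fun k hk => ?_
        simp only [ext0, dif_neg hk]
        exact h.eq_smul k ω
      have hind := h.indep.indepFun_finset₀ {o} ({o}ᶜ : Finset κ) (by simp)
        fun i => (h.law i).aemeasurable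
      have hind' : IndepFun (z o) (fun ω => ((0 : ℂ), normalize P V ω)) P := by
        have hm1 : Measurable fun x : ({o} : Finset κ) → Fin M → ℂ => x ⟨o, by simp⟩ := by
          fun_prop
        have hm2 : Measurable fun x : ({o}ᶜ : Finset κ) → Fin M → ℂ => ((0 : ℂ),
            (((√(∫ ω', sqNorm (V ω') ∂P))⁻¹ : ℝ) : ℂ) • ppzfVec S t (ext0 x)) :=
          measurable_const.prodMk
            ((measurable_const_smul _).comp ((measurable_ppzfVec S t).comp hext))
        refine (hind.comp hm1 hm2).congr (.of_forall fun ω => rfl) (.of_forall fun ω => ?_)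
        simp only [Function.comp, normalize, hVe]
      have hm := moments_add_inner_gaussian (A := fun _ => 0) (h.law o) hind' MemLp.zero'
        (aemeasurable_normalize (h.aemeasurable_ppzfVec t)) (integrable_sqNorm_normalize hVint) 1
      simp only [Complex.ofReal_one, one_mul, zero_add, integral_zero, norm_zero, ne_eq,
        OfNat.ofNat_ne_zero, not_false_eq_true, zero_pow, one_pow] at hm
      rw [integral_sqNorm_normalize hVpos] at hm
      simpa using hm

/-- Mean and second moment of the inner product of the precoder with a channel correlated with
the estimate for user `o`. -/
lemma IsGaussianFamily.moments_inner_channel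
    (h : IsGaussianFamily P (fun k => (c k : ℂ)) z v) (hc : ∀ k, 0 < c k) (hn : n + S.card = M)
    (hn0 : 0 < n) {e g : Ω → Fin M → ℂ} (he : HasLaw e (stdComplexGaussian (Fin M)) P)
    (hind : IndepFun e (fun ω k => z k ω) P) {o : κ} {a b : ℝ}
    (hg : ∀ ω, g ω = (a : ℂ) • z o ω + (b : ℂ) • e ω) (t : κ) :
    MemLp (fun ω => star (g ω) ⬝ᵥ normalize P (fun ω => ppzfVec S t fun k => v k ω) ω) 2 P ∧
    ∫ ω, star (g ω) ⬝ᵥ normalize P (fun ω => ppzfVec S t fun k => v k ω) ω ∂P =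
      ((if t = o then a * √n else 0 : ℝ) : ℂ) ∧
    ∫ ω, ‖star (g ω) ⬝ᵥ normalize P (fun ω => ppzfVec S t fun k => v k ω) ω‖ ^ 2 ∂P =
      (if t = o then a ^ 2 * n else 0) + (b ^ 2 + if o ∈ S then 0 else a ^ 2) := by
  set V : Ω → Fin M → ℂ := fun ω => ppzfVec S t fun k => v k ω with hV
  obtain ⟨h1, h2, h3⟩ := h.moments_inner_precoder hc hn hn0 o t
  have hVpos := h.integral_sqNorm_ppzfVec_pos hn hn0 t
  have hVint := h.integrable_sqNorm_ppzfVec hn hn0 t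
  have hx : ∀ ω, star (g ω) ⬝ᵥ normalize P V ω =
      a * (star (z o ω) ⬝ᵥ normalize P V ω) + b * (star (e ω) ⬝ᵥ normalize P V ω) := by
    intro ω
    rw [hg, star_add, star_smul, star_smul, add_dotProduct, smul_dotProduct, smul_dotProduct]
    simp only [smul_eq_mul, RCLike.star_def, Complex.conj_ofReal]
  have hmV : Measurable fun x : κ → Fin M → ℂ =>
      (((√(∫ ω', sqNorm (V ω') ∂P))⁻¹ : ℝ) : ℂ) • ppzfVec S t (fun k => (c k : ℂ) • x k) := by
    have hs : Measurable fun (x : κ → Fin M → ℂ) k => (c k : ℂ) • x k := by fun_prop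
    exact (measurable_const_smul _).comp ((measurable_ppzfVec S t).comp hs)
  -- Both components are functions of the family `z`, so `e` is independent of the pair although the
  -- components depend on each other.
  have hind' : IndepFun e (fun ω => ((a : ℂ) * (star (z o ω) ⬝ᵥ normalize P V ω),
      normalize P V ω)) P := by
    have hm : Measurable fun x : κ → Fin M → ℂ =>
        ((a : ℂ) * (star (x o) ⬝ᵥ ((((√(∫ ω', sqNorm (V ω') ∂P))⁻¹ : ℝ) : ℂ) •
          ppzfVec S t (fun k => (c k : ℂ) • x k))),
        (((√(∫ ω', sqNorm (V ω') ∂P))⁻¹ : ℝ) : ℂ) • ppzfVec S t (fun k => (c k : ℂ) • x k)) := by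
      refine Measurable.prodMk (Measurable.const_mul ?_ _) hmV
      simp only [dotProduct, Pi.star_apply, RCLike.star_def]
      refine Finset.measurable_sum _ fun m _ => Measurable.mul (by fun_prop) ?_
      exact (measurable_pi_apply m).comp hmV
    refine (hind.comp measurable_id hm).congr (.of_forall fun ω => rfl) (.of_forall fun ω => ?_)
    simp only [Function.comp, normalize, hV, ← h.eq_smul]
  have hm := moments_add_inner_gaussian he hind' (h1.const_mul (a : ℂ))
    (aemeasurable_normalize (h.aemeasurable_ppzfVec t)) (integrable_sqNorm_normalize hVint) b
  simp_rw [hx]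
  refine ⟨hm.1, hm.2.1.trans ?_, hm.2.2.trans ?_⟩
  · rw [integral_const_mul, h2]
    split_ifs <;> simp
  · simp_rw [norm_mul, mul_pow, Complex.norm_real, Real.norm_eq_abs, sq_abs]
    rw [integral_const_mul, h3, integral_sqNorm_normalize hVpos]
    split_ifs <;> ring

end AccessPoint

/-! ### Blocks of a standard complex Gaussian vector -/

lemma map_uncurry_pi_stdComplexGaussian (B D : Type*) [Fintype B] [Fintype D] :
    (Measure.pi fun _ : B => stdComplexGaussian D).map (fun x (q : B × D) => x q.1 q.2) =
      stdComplexGaussian (B × D) := by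
  refine (Measure.pi_eq fun s hs => ?_).symm
  have hm : Measurable fun (x : B → D → ℂ) (q : B × D) => x q.1 q.2 := by fun_prop
  rw [Measure.map_apply hm (MeasurableSet.univ_pi hs)]
  have : (fun (x : B → D → ℂ) (q : B × D) => x q.1 q.2) ⁻¹' Set.univ.pi s =
      Set.univ.pi fun b => Set.univ.pi fun d => s (b, d) := by
    ext x
    simp [Set.mem_pi]
  rw [this, Measure.pi_pi]
  simp_rw [stdComplexGaussian, Measure.pi_pi]
  rw [Fintype.prod_prod_type]

section Blocks

variable {Ω : Type*} [MeasurableSpace Ω] {P : Measure Ω} {B D : Type*} [Fintype B] [Fintype D]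
  {Z : Ω → B × D → ℂ}

lemma hasLaw_curry (hZ : HasLaw Z (stdComplexGaussian (B × D)) P) :
    HasLaw (fun ω b d => Z ω (b, d)) (Measure.pi fun _ : B => stdComplexGaussian D) P := by
  have hm : Measurable fun (x : B × D → ℂ) (b : B) (d : D) => x (b, d) := by fun_prop
  have hm' : Measurable fun (x : B → D → ℂ) (q : B × D) => x q.1 q.2 := by fun_prop
  have hlaw : HasLaw (fun (x : B × D → ℂ) (b : B) (d : D) => x (b, d))
      (Measure.pi fun _ : B => stdComplexGaussian D) (stdComplexGaussian (B × D)) := by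
    refine ⟨hm.aemeasurable, ?_⟩
    rw [← map_uncurry_pi_stdComplexGaussian, Measure.map_map hm hm']
    exact Measure.map_id
  exact hlaw.comp hZ

lemma hasLaw_block (hZ : HasLaw Z (stdComplexGaussian (B × D)) P) (b : B) :
    HasLaw (fun ω d => Z ω (b, d)) (stdComplexGaussian D) P :=
  (measurePreserving_eval (fun _ : B => stdComplexGaussian D) b).fun_comp_hasLaw (hasLaw_curry hZ)

lemma iIndepFun_blocks [IsProbabilityMeasure P] (hZ : HasLaw Z (stdComplexGaussian (B × D)) P) :
    iIndepFun (fun b ω d => Z ω (b, d)) P := by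
  rw [iIndepFun_iff_map_fun_eq_pi_map fun b => (hasLaw_block hZ b).aemeasurable]
  simp_rw [(hasLaw_block hZ _).map_eq]
  exact (hasLaw_curry hZ).map_eq

end Blocks

/-! ### Normalized channel estimates and estimation errors -/

section Representation

variable {L K M τ : ℕ}

/-- Index type of the scalar random entries. -/
abbrev EntryIndex (L K M τ : ℕ) : Type :=
  (Fin L × Fin K × Fin M) ⊕ (Fin L × Fin M) ⊕ (Fin L × Fin M × Fin τ)

/-- Coefficients of the fading entry `gE l m`. -/
def eveRow (l : Fin L) (m : Fin M) : EntryIndex L K M τ → ℂ :=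
  Sum.elim 0 (Sum.elim (fun i => if i = (l, m) then 1 else 0) 0)

lemma eveRow_dotProduct (l : Fin L) (m : Fin M) (x : EntryIndex L K M τ → ℂ) :
    eveRow l m ⬝ᵥ x = x (.inr (.inl (l, m))) := by
  simp [dotProduct, Fintype.sum_sum_type, eveRow]

lemma eveRow_dotProduct_eveRow (l l' : Fin L) (m m' : Fin M) :
    (eveRow l m : EntryIndex L K M τ → ℂ) ⬝ᵥ star (eveRow l' m') =
      if l = l' ∧ m = m' then 1 else 0 := by
  rw [eveRow_dotProduct, Pi.star_apply]
  simp [eveRow, apply_ite]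

variable [NeZero K]

/-- Coefficients of the normalized estimate of `h l k` at antenna `m` in terms of all entries. -/
def estRow (p : Params L K M τ) (l : Fin L) (k : Fin K) (m : Fin M) : EntryIndex L K M τ → ℂ :=
  Sum.elim (fun i => if i = (l, k, m) then ((√(τ * p.ρu * p.β l k) / √(pilotVar p l k) : ℝ) : ℂ)
      else 0)
    (Sum.elim (fun i => if i = (l, m) then
        (if k = 0 then ((√(τ * p.ρE * p.βE l) / √(pilotVar p l k) : ℝ) : ℂ) else 0) else 0)
      (fun i => if i.1 = l then if i.2.1 = m then
        ((√(pilotVar p l k))⁻¹ : ℝ) * p.φ k i.2.2 else 0 else 0))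

/-- Correlation of the eavesdropper's fading with the normalized estimate of user `0`. -/
def eveCorr (p : Params L K M τ) (l : Fin L) : ℝ := √(τ * p.ρE * p.βE l) / √(pilotVar p l 0)

variable {p : Params L K M τ}

lemma Params.Admissible.one_le_pilotVar (hp : p.Admissible) (l : Fin L) (k : Fin K) :
    1 ≤ pilotVar p l k := by
  have h1 := (hp.β_pos l k).le
  have h2 := hp.βE_nonneg l
  have h3 := hp.ρu_pos.le
  have h4 := hp.ρE_nonneg
  unfold pilotVar
  split_ifs
  · have : 0 ≤ τ * p.ρu * p.β l k + τ * p.ρE * p.βE l := by positivity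
    linarith
  · have : 0 ≤ τ * p.ρu * p.β l k := by positivity
    linarith

lemma Params.Admissible.pilotVar_pos (hp : p.Admissible) (l : Fin L) (k : Fin K) :
    0 < pilotVar p l k := one_pos.trans_le (hp.one_le_pilotVar l k)

lemma Params.Admissible.eveCorr_sq (hp : p.Admissible) (l : Fin L) :
    eveCorr p l ^ 2 = τ * p.ρE * p.βE l / pilotVar p l 0 := by
  have h2 := hp.βE_nonneg l
  have h4 := hp.ρE_nonneg
  rw [eveCorr, div_pow, Real.sq_sqrt (by positivity), Real.sq_sqrt (hp.pilotVar_pos l 0).le]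

/-- The noise term `1` in `pilotVar` makes this strict, so the estimation error is nondegenerate and
can be normalized. -/
lemma Params.Admissible.eveCorr_sq_lt_one (hp : p.Admissible) (l : Fin L) :
    eveCorr p l ^ 2 < 1 := by
  have h1 := (hp.β_pos l 0).le
  have h3 := hp.ρu_pos.le
  rw [hp.eveCorr_sq, div_lt_one (hp.pilotVar_pos l 0), pilotVar, if_pos rfl]
  have : 0 ≤ τ * p.ρu * p.β l 0 := by positivity
  linarith

/-- On the diagonal the squared coefficients add up to `pilotVar / pilotVar`. Estimates of different
users at one antenna share only noise entries, whose coefficients are orthogonal because the pilots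
are. -/
lemma Params.Admissible.estRow_dotProduct_estRow (hp : p.Admissible) (l l' : Fin L) (k k' : Fin K)
    (m m' : Fin M) :
    estRow p l k m ⬝ᵥ star (estRow p l' k' m') = if l = l' ∧ k = k' ∧ m = m' then 1 else 0 := by
  have h1 := (hp.β_pos l k).le
  have h2 := hp.βE_nonneg l
  have h3 := hp.ρu_pos.le
  have h4 := hp.ρE_nonneg
  have hv := hp.pilotVar_pos l k
  have hpil : ∑ j, p.φ k j * conj (p.φ k' j) = if k = k' then 1 else 0 := by
    have := hp.pilots k' k
    simp only [dotProduct, Pi.star_apply, RCLike.star_def] at this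
    rw [Finset.sum_congr rfl fun j _ => mul_comm (p.φ k j) _, this]
    simp [eq_comm]
  simp only [dotProduct, Fintype.sum_sum_type, estRow, Sum.elim_inl, Sum.elim_inr, Pi.star_apply,
    RCLike.star_def]
  by_cases hl : l = l'
  · by_cases hm : m = m'
    · subst hl hm
      have hN : ∑ i : Fin L × Fin M × Fin τ, (if i.1 = l then if i.2.1 = m then
          (((√(pilotVar p l k))⁻¹ : ℝ) : ℂ) * p.φ k i.2.2 else 0 else 0) *
          conj (if i.1 = l then if i.2.1 = m then
          (((√(pilotVar p l k'))⁻¹ : ℝ) : ℂ) * p.φ k' i.2.2 else 0 else 0) =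
          ((√(pilotVar p l k))⁻¹ * (√(pilotVar p l k'))⁻¹ : ℝ) * if k = k' then 1 else 0 := by
        rw [← hpil, Finset.mul_sum]
        simp only [Fintype.sum_prod_type]
        rw [Finset.sum_eq_single l (by intro b _ hb; simp [hb]) (by simp),
          Finset.sum_eq_single m (by intro b _ hb; simp [hb]) (by simp)]
        refine Finset.sum_congr rfl fun j _ => ?_
        simp only [if_true, map_mul, Complex.conj_ofReal]
        push_cast
        ring
      rw [hN]
      by_cases hk : k = k'
      · subst hk
        simp only [and_self, if_true, mul_one]
        rw [Finset.sum_eq_single (l, k, m) (by intro b _ hb; simp [hb]) (by simp),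
          Finset.sum_eq_single (l, m) (by intro b _ hb; simp [hb]) (by simp)]
        simp only [if_true]
        have key : √(τ * p.ρu * p.β l k) / √(pilotVar p l k) *
            (√(τ * p.ρu * p.β l k) / √(pilotVar p l k)) +
            ((if k = 0 then √(τ * p.ρE * p.βE l) / √(pilotVar p l k) *
            (√(τ * p.ρE * p.βE l) / √(pilotVar p l k)) else 0) +
            (√(pilotVar p l k))⁻¹ * (√(pilotVar p l k))⁻¹) = 1 := by
          rw [div_mul_div_comm, div_mul_div_comm, ← mul_inv, Real.mul_self_sqrt hv.le,
            Real.mul_self_sqrt (by positivity), Real.mul_self_sqrt (by positivity)]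
          have hv' := hv.ne'
          split_ifs with hk0
          · field_simp
            rw [pilotVar, if_pos hk0]
            ring
          · field_simp
            rw [pilotVar, if_neg hk0]
            ring
        split_ifs at key ⊢ with hk0
        · simp only [Complex.conj_ofReal]
          exact_mod_cast key
        · simp only [Complex.conj_ofReal, map_zero, mul_zero]
          exact_mod_cast key
      · have hne : ¬(l = l ∧ k = k' ∧ m = m) := by tauto
        rw [if_neg hk, if_neg hne, mul_zero, add_zero]
        refine (congrArg₂ (· + ·) (Finset.sum_eq_zero fun i _ => ?_)
          (Finset.sum_eq_zero fun i _ => ?_)).trans (add_zero 0)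
        · by_cases hi : i = (l, k, m)
          · simp [hi, hk]
          · simp [hi]
        · by_cases h0 : k = 0
          · have : k' ≠ 0 := fun h => hk (h0.trans h.symm)
            simp [this]
          · simp [h0]
    · have hne : ¬(l = l' ∧ k = k' ∧ m = m') := by tauto
      rw [if_neg hne]
      refine (congrArg₂ (· + ·) (Finset.sum_eq_zero fun i _ => ?_)
        (congrArg₂ (· + ·) (Finset.sum_eq_zero fun i _ => ?_)
          (Finset.sum_eq_zero fun i _ => ?_))).trans (by simp) <;>
      (try simp only [Prod.ext_iff]) <;> split_ifs <;> simp_all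
  · have hne : ¬(l = l' ∧ k = k' ∧ m = m') := by tauto
    rw [if_neg hne]
    refine (congrArg₂ (· + ·) (Finset.sum_eq_zero fun i _ => ?_)
      (congrArg₂ (· + ·) (Finset.sum_eq_zero fun i _ => ?_)
        (Finset.sum_eq_zero fun i _ => ?_))).trans (by simp) <;>
    (try simp only [Prod.ext_iff]) <;> split_ifs <;> simp_all

lemma eveRow_dotProduct_estRow (l l' : Fin L) (k : Fin K) (m m' : Fin M) :
    eveRow l m ⬝ᵥ star (estRow p l' k m') =
      if l = l' ∧ m = m' ∧ k = 0 then (eveCorr p l : ℂ) else 0 := by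
  rw [eveRow_dotProduct, Pi.star_apply]
  simp only [estRow, Sum.elim_inr, Sum.elim_inl, Prod.ext_iff]
  by_cases hl : l = l'
  · by_cases hm : m = m'
    · by_cases hk : k = 0
      · subst hl hm hk
        simp only [and_self, if_true, RCLike.star_def, Complex.conj_ofReal, eveCorr]
      · simp [hk]
    · simp [hm]
  · simp [hl]

lemma estRow_dotProduct_eveRow (l l' : Fin L) (k : Fin K) (m m' : Fin M) :
    estRow p l k m ⬝ᵥ star (eveRow l' m') =
      if l' = l ∧ m' = m ∧ k = 0 then (eveCorr p l' : ℂ) else 0 := by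
  rw [Matrix.dotProduct_star, eveRow_dotProduct_estRow]
  split_ifs <;> simp

/-- Coefficients of the normalized estimates (`some k`) and of the normalized error of the estimate
of the eavesdropper's channel (`none`) in terms of all entries. -/
def repRow (p : Params L K M τ) (l : Fin L) : Option (Fin K) → Fin M → EntryIndex L K M τ → ℂ
  | none, m => (((√(1 - eveCorr p l ^ 2))⁻¹ : ℝ) : ℂ) •
      (eveRow l m - (eveCorr p l : ℂ) • estRow p l 0 m)
  | some k, m => estRow p l k m

/-- The matrix with the rows `repRow`. -/
def repMatrix (p : Params L K M τ) :
    Matrix ((Fin L × Option (Fin K)) × Fin M) (EntryIndex L K M τ) ℂ :=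
  Matrix.of fun q => repRow p q.1.1 q.1.2 q.2

/-- One Gram–Schmidt step at each antenna: `eveRow` is a unit vector that meets the estimate rows
only at user `0`, with inner product `eveCorr`. Subtracting this component leaves squared norm `1 -
eveCorr²`. -/
lemma Params.Admissible.repMatrix_mul_conjTranspose (hp : p.Admissible) :
    repMatrix p * (repMatrix p)ᴴ = 1 := by
  ext ⟨⟨l, k⟩, m⟩ ⟨⟨l', k'⟩, m'⟩
  have h0 : (repMatrix p * (repMatrix p)ᴴ) ((l, k), m) ((l', k'), m') =
      repRow p l k m ⬝ᵥ star (repRow p l' k' m') := rfl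
  have hs : ∀ l : Fin L, 0 < 1 - eveCorr p l ^ 2 := fun l => by
    linarith [hp.eveCorr_sq_lt_one l]
  rw [h0, Matrix.one_apply]
  rcases k with _ | k <;> rcases k' with _ | k' <;>
    simp only [repRow, star_smul, star_sub, smul_dotProduct,
      dotProduct_smul, sub_dotProduct, dotProduct_sub, eveRow_dotProduct_eveRow,
      eveRow_dotProduct_estRow, estRow_dotProduct_eveRow, hp.estRow_dotProduct_estRow, Prod.mk.injEq,
      Option.some.injEq, reduceCtorEq, and_false, false_and, if_false, smul_eq_mul]
  · by_cases h : l = l' ∧ m = m'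
    · obtain ⟨rfl, rfl⟩ := h
      simp only [and_self, if_true, RCLike.star_def, Complex.conj_ofReal]
      have h1 := (Real.sqrt_pos.2 (hs l)).ne'
      have h2 := Real.sq_sqrt (hs l).le
      norm_cast
      field_simp
      rw [h2]
      ring
    · have h' : ¬(l' = l ∧ m' = m) := fun h' => h ⟨h'.1.symm, h'.2.symm⟩
      simp [h, h']
  · by_cases h : l = l' ∧ m = m' ∧ k' = 0
    · obtain ⟨rfl, rfl, rfl⟩ := h
      simp
    · have h' : ¬(l = l' ∧ (0 : Fin K) = k' ∧ m = m') := by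
        rintro ⟨rfl, rfl, rfl⟩; exact h ⟨rfl, rfl, rfl⟩
      simp [h, h']
  · by_cases h : l = l' ∧ k = 0 ∧ m = m'
    · obtain ⟨rfl, rfl, rfl⟩ := h
      simp
    · have h' : ¬(l' = l ∧ m' = m ∧ k = 0) := by
        rintro ⟨rfl, rfl, rfl⟩; exact h ⟨rfl, rfl, rfl⟩
      simp [h, h']
  · simp only [and_assoc]

/-- The normalized estimates and errors at one outcome. -/
def normalized {Ω : Type*} (p : Params L K M τ) (r : Randomness Ω L K M τ) (ω : Ω) :
    (Fin L × Option (Fin K)) × Fin M → ℂ :=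
  repMatrix p *ᵥ fun i => r.entries i ω

/-! ### Estimates and eavesdropper channel in the normalized variables -/

section Outcome

variable {Ω : Type*} (r : Randomness Ω L K M τ)

/-- Despreading with `φ k` keeps user `k` alone, together with the eavesdropper when `k = 0`. -/
lemma Params.Admissible.pilotMatrix_mulVec (hp : p.Admissible) (l : Fin L) (k : Fin K) (ω : Ω)
    (m : Fin M) :
    (pilotMatrix p r l ω *ᵥ p.φ k) m = √(τ * p.ρu) * (√(p.β l k) * r.g l k m ω) +
      (if k = 0 then √(τ * p.ρE) * (√(p.βE l) * r.gE l m ω) else 0) +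
      ∑ j, r.N l m j ω * p.φ k j := by
  have hvec : ∀ (x : Fin M → ℂ) (k' : Fin K), Matrix.vecMulVec x (star (p.φ k')) *ᵥ p.φ k =
      if k' = k then x else 0 := by
    intro x k'
    rw [Matrix.vecMulVec_mulVec, hp.pilots]
    split_ifs <;> simp
  rw [pilotMatrix, Matrix.add_mulVec, Matrix.add_mulVec, Matrix.smul_mulVec, Matrix.smul_mulVec,
    Matrix.sum_mulVec]
  simp_rw [hvec]
  simp only [Finset.sum_ite_eq', Finset.mem_univ, if_true, Pi.add_apply, Pi.smul_apply,
    smul_eq_mul, h]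
  congr 1
  congr 1
  by_cases hk : k = 0
  · simp [hk, hE]
  · simp [hk, Ne.symm hk]

lemma estRow_dotProduct_entries (l : Fin L) (k : Fin K) (m : Fin M) (ω : Ω) :
    estRow p l k m ⬝ᵥ (fun i => r.entries i ω) =
      ((√(τ * p.ρu * p.β l k) / √(pilotVar p l k) : ℝ) : ℂ) * r.g l k m ω +
      ((if k = 0 then ((√(τ * p.ρE * p.βE l) / √(pilotVar p l k) : ℝ) : ℂ) * r.gE l m ω else 0) +
      ((√(pilotVar p l k))⁻¹ : ℝ) * ∑ j, r.N l m j ω * p.φ k j) := by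
  simp only [dotProduct, Fintype.sum_sum_type, estRow, Sum.elim_inl, Sum.elim_inr,
    Randomness.entries]
  congr 1
  · rw [Finset.sum_eq_single (l, k, m) (by intro b _ hb; simp [hb]) (by simp), if_pos rfl]
  · congr 1
    · rw [Finset.sum_eq_single (l, m) (by intro b _ hb; simp [hb]) (by simp), if_pos rfl]
      split_ifs <;> simp
    · simp only [Fintype.sum_prod_type]
      rw [Finset.sum_eq_single l (by intro b _ hb; simp [hb]) (by simp),
        Finset.sum_eq_single m (by intro b _ hb; simp [hb]) (by simp), Finset.mul_sum]
      refine Finset.sum_congr rfl fun j _ => ?_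
      simp only [if_true]
      ring

lemma normalized_some (l : Fin L) (k : Fin K) (m : Fin M) (ω : Ω) :
    normalized p r ω ((l, some k), m) = estRow p l k m ⬝ᵥ (fun i => r.entries i ω) := rfl

lemma normalized_none (l : Fin L) (m : Fin M) (ω : Ω) :
    normalized p r ω ((l, none), m) = (((√(1 - eveCorr p l ^ 2))⁻¹ : ℝ) : ℂ) *
      (r.gE l m ω - eveCorr p l * normalized p r ω ((l, some 0), m)) := by
  have h0 : normalized p r ω ((l, none), m) = repRow p l none m ⬝ᵥ (fun i => r.entries i ω) := rfl
  rw [h0, normalized_some, repRow, smul_dotProduct, sub_dotProduct, smul_dotProduct,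
    eveRow_dotProduct]
  rfl

lemma Params.Admissible.γ_pos (hp : p.Admissible) (l : Fin L) (k : Fin K) (hτ : 0 < τ) :
    0 < γ p l k := by
  have h1 := hp.β_pos l k
  have h3 := hp.ρu_pos
  have hv := hp.pilotVar_pos l k
  have hτ' : (0 : ℝ) < τ := by exact_mod_cast hτ
  unfold γ
  positivity

lemma Params.Admissible.τ_pos (hp : p.Admissible) : 0 < τ := by
  rcases Nat.eq_zero_or_pos τ with h | h
  · subst h
    -- For `τ = 0` the pilot of user `0` would have the empty sum `0` as its squared norm instead of
    -- `1`.
    have := hp.pilots 0 0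
    simp at this
  · exact h

lemma Params.Admissible.hhat_eq (hp : p.Admissible) (l : Fin L) (k : Fin K) (ω : Ω) :
    hhat p r l k ω = (√(γ p l k) : ℂ) • fun m => normalized p r ω ((l, some k), m) := by
  have h1 := (hp.β_pos l k).le
  have h2 := hp.βE_nonneg l
  have h3 := hp.ρu_pos.le
  have h4 := hp.ρE_nonneg
  have hv := hp.pilotVar_pos l k
  have hsv : (√(pilotVar p l k) : ℂ) ≠ 0 := by exact_mod_cast (Real.sqrt_pos.2 hv).ne'
  have hv2 : (pilotVar p l k : ℂ) = √(pilotVar p l k) * √(pilotVar p l k) := by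
    exact_mod_cast (Real.mul_self_sqrt hv.le).symm
  have hγ : √(γ p l k) = √(τ * p.ρu) * p.β l k / √(pilotVar p l k) := by
    rw [γ, Real.sqrt_div (by positivity), Real.sqrt_mul (by positivity), Real.sqrt_sq h1]
  ext m
  rw [hhat, Pi.smul_apply, Pi.smul_apply, hp.pilotMatrix_mulVec, normalized_some,
    estRow_dotProduct_entries, hγ, Real.sqrt_mul (by positivity) (p.β l k),
    Real.sqrt_mul (by positivity) (p.βE l)]
  simp only [smul_eq_mul]
  push_cast
  rw [hv2]
  split_ifs <;> field_simp <;> ring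

/-- Identifies `γE` as the share of the variance `βE` that the pilot observation explains; `ρu` and
`β l 0` cancel. -/
lemma Params.Admissible.γE_eq (hp : p.Admissible) (l : Fin L) :
    γE p l = p.βE l * eveCorr p l ^ 2 := by
  have h1 := (hp.β_pos l 0).ne'
  have h3 := hp.ρu_pos.ne'
  have hv := (hp.pilotVar_pos l 0).ne'
  rw [γE, γ, hp.eveCorr_sq]
  field_simp

/-- The definition of the normalized error, solved for the fading `gE`: an explained part of
variance `γE` plus an independent error of variance `βE - γE`. -/
lemma Params.Admissible.hE_eq (hp : p.Admissible) (l : Fin L) (ω : Ω) :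
    hE p r l ω = (√(γE p l) : ℂ) • (fun m => normalized p r ω ((l, some 0), m)) +
      (√(p.βE l - γE p l) : ℂ) • fun m => normalized p r ω ((l, none), m) := by
  have hb := hp.βE_nonneg l
  have hs : 0 < 1 - eveCorr p l ^ 2 := by linarith [hp.eveCorr_sq_lt_one l]
  have hc : 0 ≤ eveCorr p l := by unfold eveCorr; positivity
  have e1 : √(γE p l) = √(p.βE l) * eveCorr p l := by
    rw [hp.γE_eq, Real.sqrt_mul hb, Real.sqrt_sq hc]
  have e2 : √(p.βE l - γE p l) = √(p.βE l) * √(1 - eveCorr p l ^ 2) := by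
    rw [hp.γE_eq, ← Real.sqrt_mul hb]
    ring_nf
  have hne : (√(1 - eveCorr p l ^ 2) : ℂ) ≠ 0 := by exact_mod_cast (Real.sqrt_pos.2 hs).ne'
  ext m
  rw [Pi.add_apply, Pi.smul_apply, Pi.smul_apply, normalized_none, e1, e2, hE]
  simp only [smul_eq_mul]
  push_cast
  field_simp
  ring

end Outcome

lemma Params.Admissible.hasLaw_normalized {Ω : Type*} [MeasurableSpace Ω] {P : Measure Ω}
    (hp : p.Admissible) {r : Randomness Ω L K M τ} (hr : r.IsRayleigh P) :
    HasLaw (normalized p r) (stdComplexGaussian ((Fin L × Option (Fin K)) × Fin M)) P := by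
  have := hr.indep.isProbabilityMeasure
  have hX : HasLaw (fun ω i => r.entries i ω) (stdComplexGaussian (EntryIndex L K M τ)) P := by
    refine ⟨aemeasurable_pi_lambda _ fun i => (hr.law i).aemeasurable, ?_⟩
    rw [(iIndepFun_iff_map_fun_eq_pi_map fun i => (hr.law i).aemeasurable).1 hr.indep]
    simp_rw [(hr.law _).map_eq]
    rfl
  have hm : Measurable fun x : EntryIndex L K M τ → ℂ => repMatrix p *ᵥ x :=
    (continuous_const.matrix_mulVec continuous_id).measurable
  have hlaw : HasLaw (fun x : EntryIndex L K M τ → ℂ => repMatrix p *ᵥ x)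
      (stdComplexGaussian ((Fin L × Option (Fin K)) × Fin M))
      (stdComplexGaussian (EntryIndex L K M τ)) :=
    ⟨hm.aemeasurable, map_mulVec_stdComplexGaussian _ hp.repMatrix_mul_conjTranspose⟩
  exact hlaw.comp hX

end Representation

/-! ### The gains at the eavesdropper -/

section Gains

variable {Ω : Type*} {L K M τ : ℕ} [NeZero K] {p : Params L K M τ}

lemma HS_eq_colMat (r : Randomness Ω L K M τ) (l : Fin L) (ω : Ω) :
    HS p r l ω = colMat (Subtype.val : p.S l → Fin K) fun k => hhat p r l k ω := by
  ext m i
  simp [HS, selS, Hhat, colMat, Matrix.mul_apply]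

variable [MeasurableSpace Ω] {P : Measure Ω}

lemma w_eq_normalize (r : Randomness Ω L K M τ) (l : Fin L) (t : Fin K) :
    w P p r l t = normalize P fun ω => ppzfVec (p.S l) t fun k => hhat p r l k ω := by
  by_cases ht : t ∈ p.S l
  · rw [w, if_pos ht]
    congr 1
    ext1 ω
    rw [vPZF, pinvS, HS_eq_colMat, ppzfVec, if_pos ht]
  · rw [w, if_neg ht]
    congr 1
    ext1 ω
    rw [vPMRT, projB, pinvS, HS_eq_colMat, ppzfVec, if_neg ht, orthProj]

variable {r : Randomness Ω L K M τ}

lemma isGaussianFamily_hhat (hp : p.Admissible) (hr : r.IsRayleigh P) (l : Fin L) :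
    IsGaussianFamily P (fun k => (√(γ p l k) : ℂ))
      (fun k ω m => normalized p r ω ((l, some k), m)) (hhat p r l) := by
  have := hr.indep.isProbabilityMeasure
  have hZ := hp.hasLaw_normalized hr
  refine ⟨?_, fun k => hasLaw_block hZ (l, some k), fun k => ?_, fun k ω => hp.hhat_eq r l k ω⟩
  · exact (iIndepFun_blocks hZ).precomp (g := fun k : Fin K => (l, some k))
      fun a b hab => by simpa using hab
  · exact_mod_cast (Real.sqrt_pos.2 (hp.γ_pos l k hp.τ_pos)).ne'

/-- The blocks of different access points are independent. -/
lemma indepFun_normalized (hp : p.Admissible) (hr : r.IsRayleigh P)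
    (S T : Finset (Fin L × Option (Fin K))) (hST : Disjoint S T) :
    IndepFun (fun ω (b : S) m => normalized p r ω (b, m))
      (fun ω (b : T) m => normalized p r ω (b, m)) P := by
  have := hr.indep.isProbabilityMeasure
  have hZ := hp.hasLaw_normalized hr
  exact (iIndepFun_blocks hZ).indepFun_finset₀ S T hST fun b => (hasLaw_block hZ b).aemeasurable

lemma Params.Admissible.γE_nonneg (hp : p.Admissible) (l : Fin L) : 0 ≤ γE p l := by
  have := hp.βE_nonneg l
  rw [hp.γE_eq]
  positivity

lemma Params.Admissible.γE_le (hp : p.Admissible) (l : Fin L) : γE p l ≤ p.βE l := by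
  rw [hp.γE_eq]
  exact mul_le_of_le_one_right (hp.βE_nonneg l) (hp.eveCorr_sq_lt_one l).le

/-- The single-AP moments with `a² = γE` and `b² = βE - γE`. When user `0` is strong the explained
part does not fluctuate, which leaves variance `βE - γE`; otherwise it adds `γE` back. -/
lemma moments_inner_hE_w (hp : p.Admissible) (hr : r.IsRayleigh P) (l : Fin L) (t : Fin K) :
    MemLp (fun ω => star (hE p r l ω) ⬝ᵥ w P p r l t ω) 2 P ∧
    ∫ ω, star (hE p r l ω) ⬝ᵥ w P p r l t ω ∂P =
      ((if t = 0 then √(((M : ℝ) - (p.S l).card) * γE p l) else 0 : ℝ) : ℂ) ∧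
    ∫ ω, ‖star (hE p r l ω) ⬝ᵥ w P p r l t ω‖ ^ 2 ∂P =
      (if t = 0 then ((M : ℝ) - (p.S l).card) * γE p l else 0) +
        (p.βE l - δ p l 0 * γE p l) := by
  have := hr.indep.isProbabilityMeasure
  have hlt := hp.card_lt l
  have hn : ((M - (p.S l).card : ℕ) : ℝ) = (M : ℝ) - (p.S l).card := Nat.cast_sub hlt.le
  have hZ := hp.hasLaw_normalized hr
  have hind : IndepFun (fun ω m => normalized p r ω ((l, none), m))
      (fun ω (k : Fin K) m => normalized p r ω ((l, some k), m)) P := by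
    have h := indepFun_normalized hp hr {(l, none)} {(l, none)}ᶜ (by simp)
    have hmem : ∀ k : Fin K, (l, some k) ∈ ({(l, none)}ᶜ : Finset (Fin L × Option (Fin K))) := by
      simp
    exact h.comp
      (φ := fun x : ({(l, none)} : Finset (Fin L × Option (Fin K))) → Fin M → ℂ =>
        x ⟨(l, none), by simp⟩)
      (ψ := fun x : ({(l, none)}ᶜ : Finset (Fin L × Option (Fin K))) → Fin M → ℂ =>
        fun k => x ⟨(l, some k), hmem k⟩) (by fun_prop) (by fun_prop)
  have key := (isGaussianFamily_hhat hp hr l).moments_inner_channel (S := p.S l)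
    (n := M - (p.S l).card) (fun k => Real.sqrt_pos.2 (hp.γ_pos l k hp.τ_pos)) (by lia) (by lia)
    (hasLaw_block hZ (l, none)) hind (fun ω => hp.hE_eq r l ω) t
  rw [← w_eq_normalize, hn, Real.sq_sqrt (hp.γE_nonneg l),
    Real.sq_sqrt (by linarith [hp.γE_le l])] at key
  refine ⟨key.1, key.2.1.trans ?_, key.2.2.trans ?_⟩
  · rw [mul_comm ((M : ℝ) - _), Real.sqrt_mul (hp.γE_nonneg l)]
  · unfold δ
    split_ifs <;> ring

lemma indepFun_inner_hE_w (hp : p.Admissible) (hr : r.IsRayleigh P) {l l' : Fin L} (hl : l ≠ l')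
    (t : Fin K) :
    IndepFun (fun ω => star (hE p r l ω) ⬝ᵥ w P p r l t ω)
      (fun ω => star (hE p r l' ω) ⬝ᵥ w P p r l' t ω) P := by
  let T : Fin L → Finset (Fin L × Option (Fin K)) := fun l => Finset.univ.filter fun b => b.1 = l
  have hmem : ∀ (l : Fin L) (o : Option (Fin K)), (l, o) ∈ T l := fun l o => by simp [T]
  have hdisj : Disjoint (T l) (T l') := by
    rw [Finset.disjoint_left]
    intro b hb hb'
    simp only [T, Finset.mem_filter, Finset.mem_univ, true_and] at hb hb'
    exact hl (hb.symm.trans hb')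
  let c : Fin L → ℂ := fun l =>
    (((√(∫ ω, sqNorm (ppzfVec (p.S l) t fun k => hhat p r l k ω) ∂P))⁻¹ : ℝ) : ℂ)
  -- The term of AP `l` is a function of the normalized variables at `l` alone, and the blocks of
  -- distinct APs are disjoint.
  let F : (l : Fin L) → (T l → Fin M → ℂ) → ℂ := fun l x =>
    star ((√(γE p l) : ℂ) • x ⟨(l, some 0), hmem l _⟩ +
      (√(p.βE l - γE p l) : ℂ) • x ⟨(l, none), hmem l _⟩) ⬝ᵥ
    (c l • ppzfVec (p.S l) t fun k => (√(γ p l k) : ℂ) • x ⟨(l, some k), hmem l _⟩)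
  have hF : ∀ l, Measurable (F l) := by
    intro l
    have h1 : Measurable fun (x : T l → Fin M → ℂ) (k : Fin K) =>
        (√(γ p l k) : ℂ) • x ⟨(l, some k), hmem l _⟩ := by fun_prop
    have h2 : Measurable fun x : T l → Fin M → ℂ => c l • ppzfVec (p.S l) t fun k =>
        (√(γ p l k) : ℂ) • x ⟨(l, some k), hmem l _⟩ :=
      (measurable_const_smul _).comp ((measurable_ppzfVec (p.S l) t).comp h1)
    simp only [F, dotProduct, Pi.star_apply, RCLike.star_def]
    refine Finset.measurable_sum _ fun m _ => Measurable.mul ?_ ?_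
    · simp only [Pi.add_apply, Pi.smul_apply]
      fun_prop
    · exact (measurable_pi_apply m).comp h2
  have hval : ∀ l ω, F l (fun b m => normalized p r ω (b, m)) =
      star (hE p r l ω) ⬝ᵥ w P p r l t ω := by
    intro l ω
    rw [hp.hE_eq, w_eq_normalize, normalize]
    simp only [F, c, hp.hhat_eq]
  refine ((indepFun_normalized hp hr (T l) (T l') hdisj).comp (hF l) (hF l')).congr
    (.of_forall fun ω => ?_) (.of_forall fun ω => ?_)
  · exact hval l ω
  · exact hval l' ω

lemma memLp_gainE (hp : p.Admissible) (hr : r.IsRayleigh P) (t : Fin K) :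
    MemLp (gainE P p r t) 2 P :=
  memLp_finsetSum _ fun l _ => (moments_inner_hE_w hp hr l t).1.const_mul _

lemma integrable_norm_sq_gainE (hp : p.Admissible) (hr : r.IsRayleigh P) (t : Fin K) :
    Integrable (fun ω => ‖gainE P p r t ω‖ ^ 2) P :=
  (memLp_two_iff_integrable_sq_norm (memLp_gainE hp hr t).1).1 (memLp_gainE hp hr t)

lemma integral_norm_sq_gainE (hp : p.Admissible) (hr : r.IsRayleigh P) (t : Fin K) :
    ∫ ω, ‖gainE P p r t ω‖ ^ 2 ∂P =
      (if t = 0 then (∑ l, √(p.ρ l 0 * ((M : ℝ) - (p.S l).card) * γE p l)) ^ 2 else 0) +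
        ∑ l, p.ρ l t * (p.βE l - δ p l 0 * γE p l) := by
  have h := fun l => moments_inner_hE_w hp hr l t
  have hind : ∀ l l', l ≠ l' → IndepFun
      (fun ω => (√(p.ρ l t) : ℂ) * (star (hE p r l ω) ⬝ᵥ w P p r l t ω))
      (fun ω => (√(p.ρ l' t) : ℂ) * (star (hE p r l' ω) ⬝ᵥ w P p r l' t ω)) P := fun l l' hl =>
    (indepFun_inner_hE_w hp hr hl t).comp (φ := fun x => (√(p.ρ l t) : ℂ) * x)
      (ψ := fun x => (√(p.ρ l' t) : ℂ) * x) (by fun_prop) (by fun_prop)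
  have key := integral_norm_sq_sum_of_indepFun
    (X := fun l ω => (√(p.ρ l t) : ℂ) * (star (hE p r l ω) ⬝ᵥ w P p r l t ω))
    (fun l => (h l).1.const_mul _) hind
  have hmean : ∀ l, ∫ ω, (√(p.ρ l t) : ℂ) * (star (hE p r l ω) ⬝ᵥ w P p r l t ω) ∂P =
      ((if t = 0 then √(p.ρ l 0 * ((M : ℝ) - (p.S l).card) * γE p l) else 0 : ℝ) : ℂ) := by
    intro l
    rw [integral_const_mul, (h l).2.1]
    split_ifs with ht
    · rw [ht, mul_assoc, Real.sqrt_mul (hp.ρ_nonneg l 0)]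
      push_cast
      rfl
    · simp
  have hsq : ∀ l, ∫ ω, ‖(√(p.ρ l t) : ℂ) * (star (hE p r l ω) ⬝ᵥ w P p r l t ω)‖ ^ 2 ∂P =
      p.ρ l t * ((if t = 0 then ((M : ℝ) - (p.S l).card) * γE p l else 0) +
        (p.βE l - δ p l 0 * γE p l)) := by
    intro l
    simp_rw [norm_mul, mul_pow, Complex.norm_real, Real.norm_eq_abs, sq_abs,
      Real.sq_sqrt (hp.ρ_nonneg l t)]
    rw [integral_const_mul, (h l).2.2]
  simp_rw [hmean, hsq] at key
  rw [← Complex.ofReal_sum, Complex.norm_real, Real.norm_eq_abs, sq_abs] at key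
  refine key.trans ?_
  congr 1
  · split_ifs <;> simp
  -- For `t = 0` the squared mean cancels the term `(M - |S|) γE` of the second moment, so the
  -- variance has the same form for all `t`.
  · refine Finset.sum_congr rfl fun l _ => ?_
    rw [Complex.norm_real, Real.norm_eq_abs, sq_abs]
    split_ifs with ht
    · have hlt : ((p.S l).card : ℝ) ≤ M := by exact_mod_cast (hp.card_lt l).le
      rw [Real.sq_sqrt (mul_nonneg (mul_nonneg (hp.ρ_nonneg l 0) (by linarith))
        (hp.γE_nonneg l)), ht]
      ring
    · ring

end Gains

/-! ### The error of replacing a positive variable by its mean inside a logarithm -/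

section Dispersion

variable {Ω : Type*} [MeasurableSpace Ω] {P : Measure Ω} {Z : Ω → ℝ}

lemma integrable_log_of_one_le (hZ : Integrable Z P) (h1 : ∀ ω, 1 ≤ Z ω) :
    Integrable (fun ω => Real.log (Z ω)) P := by
  refine hZ.mono' (Real.measurable_log.comp_aemeasurable hZ.1.aemeasurable).aestronglyMeasurable
    (.of_forall fun ω => ?_)
  rw [Real.norm_of_nonneg (Real.log_nonneg (h1 ω))]
  exact Real.log_le_self (by linarith [h1 ω])

variable [IsProbabilityMeasure P]

lemma one_le_integral (hZ : Integrable Z P) (h1 : ∀ ω, 1 ≤ Z ω) : 1 ≤ ∫ ω, Z ω ∂P := by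
  have := integral_mono (integrable_const (1 : ℝ)) hZ h1
  simpa using this

/-- Jensen's inequality, from the tangent line of the logarithm at the mean. -/
lemma integral_log_le_log_integral (hZ : Integrable Z P) (h1 : ∀ ω, 1 ≤ Z ω) :
    ∫ ω, Real.log (Z ω) ∂P ≤ Real.log (∫ ω, Z ω ∂P) := by
  set μ := ∫ ω, Z ω ∂P with hμ
  have hμ1 : 1 ≤ μ := one_le_integral hZ h1
  have hle : ∀ ω, Real.log (Z ω) ≤ Real.log μ + (Z ω / μ - 1) := by
    intro ω
    have hz : 0 < Z ω := by linarith [h1 ω]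
    have := Real.log_le_sub_one_of_pos (div_pos hz (by linarith : 0 < μ))
    rw [Real.log_div hz.ne' (by linarith)] at this
    linarith
  have hi : Integrable (fun ω => Z ω / μ - 1) P := (hZ.div_const μ).sub (integrable_const _)
  calc ∫ ω, Real.log (Z ω) ∂P ≤ ∫ ω, (Real.log μ + (Z ω / μ - 1)) ∂P :=
        integral_mono (integrable_log_of_one_le hZ h1) ((integrable_const _).add hi) hle
    _ = Real.log μ := by
        rw [integral_add (integrable_const _) hi, integral_sub (hZ.div_const μ)
          (integrable_const _), integral_div, ← hμ, div_self (by linarith)]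
        simp

/-- The Jensen gap is the mean of `log (μ / Z)`, which is at most the mean of `μ / Z - 1`. The
latter is exactly the dispersion. -/
lemma log_integral_sub_integral_log_le_dispersion (hZ : Integrable Z P) (h1 : ∀ ω, 1 ≤ Z ω) :
    Real.log (∫ ω, Z ω ∂P) - ∫ ω, Real.log (Z ω) ∂P ≤ dispersion P Z := by
  unfold dispersion
  set μ := ∫ ω, Z ω ∂P with hμ
  have hμ1 : 1 ≤ μ := one_le_integral hZ h1
  have hinv : Integrable (fun ω => μ / Z ω) P := by
    refine (integrable_const μ).mono'
      (hZ.1.aemeasurable.const_div μ).aestronglyMeasurable (.of_forall fun ω => ?_)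
    have hz := h1 ω
    rw [Real.norm_of_nonneg (by positivity)]
    exact div_le_self (by linarith) hz
  -- The first summand has mean zero, so only `μ / Z - 1` contributes to the dispersion.
  have hexp : ∀ ω, (Z ω - μ) ^ 2 / (Z ω * μ) = (Z ω / μ - 1) + (μ / Z ω - 1) := by
    intro ω
    have hz : Z ω ≠ 0 := by linarith [h1 ω]
    have hm : μ ≠ 0 := by linarith
    field_simp
    ring
  have hi : Integrable (fun ω => Z ω / μ - 1) P := (hZ.div_const μ).sub (integrable_const _)
  have hi' : Integrable (fun ω => μ / Z ω - 1) P := hinv.sub (integrable_const _)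
  have h0 : ∫ ω, (Z ω / μ - 1) ∂P = 0 := by
    rw [integral_sub (hZ.div_const μ) (integrable_const _), integral_div, ← hμ,
      div_self (by linarith)]
    simp
  simp_rw [hexp]
  rw [integral_add hi hi', h0, zero_add]
  have hlog := integrable_log_of_one_le hZ h1
  have : ∫ ω, (Real.log μ - Real.log (Z ω)) ∂P ≤ ∫ ω, (μ / Z ω - 1) ∂P := by
    refine integral_mono ((integrable_const _).sub hlog) hi' fun ω => ?_
    have hz : 0 < Z ω := by linarith [h1 ω]
    have := Real.log_le_sub_one_of_pos (div_pos (by linarith : 0 < μ) hz)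
    rwa [Real.log_div (by linarith) hz.ne'] at this
  rw [integral_sub (integrable_const _) hlog] at this
  simpa using this

/-- The mean of `log (1 + X / Y)` and its value at the means of `X` and `Y`. -/
lemma abs_integral_log_sub_le {X Y : Ω → ℝ} (hX : Integrable X P) (hY : Integrable Y P)
    (hX0 : ∀ ω, 0 ≤ X ω) (hY1 : ∀ ω, 1 ≤ Y ω) :
    Integrable (fun ω => Real.logb 2 (1 + X ω / Y ω)) P ∧
    |∫ ω, Real.logb 2 (1 + X ω / Y ω) ∂P -
        Real.logb 2 (1 + (∫ ω, X ω ∂P) / ∫ ω, Y ω ∂P)| ≤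
      max (dispersion P fun ω => X ω + Y ω) (dispersion P Y) / Real.log 2 := by
  have hXY1 : ∀ ω, 1 ≤ X ω + Y ω := fun ω => by linarith [hX0 ω, hY1 ω]
  have hXY : Integrable (fun ω => X ω + Y ω) P := hX.add hY
  have hsplit : ∀ x y : ℝ, 0 ≤ x → 1 ≤ y →
      Real.logb 2 (1 + x / y) = (Real.log (x + y) - Real.log y) / Real.log 2 := by
    intro x y hx hy
    have hy0 : y ≠ 0 := by linarith
    rw [Real.logb, ← Real.log_div (by linarith) hy0]
    congr 2
    field_simp
    ring
  have hEX : 0 ≤ ∫ ω, X ω ∂P := integral_nonneg hX0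
  have hEY := one_le_integral hY hY1
  have hl1 := integrable_log_of_one_le hXY hXY1
  have hl2 := integrable_log_of_one_le hY hY1
  have hlog2 : 0 < Real.log 2 := Real.log_pos (by norm_num)
  simp_rw [fun ω => hsplit (X ω) (Y ω) (hX0 ω) (hY1 ω)]
  refine ⟨(hl1.sub hl2).div_const _, ?_⟩
  rw [hsplit _ _ hEX hEY, integral_div, integral_sub hl1 hl2, ← sub_div, abs_div,
    abs_of_pos hlog2]
  gcongr
  -- The error is the difference of the Jensen gaps of `X + Y` and `Y`. Both are nonnegative, so the
  -- larger dispersion bounds it and no sum is needed.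
  have a1 := integral_log_le_log_integral hXY hXY1
  have a2 := log_integral_sub_integral_log_le_dispersion hXY hXY1
  have a3 := integral_log_le_log_integral hY hY1
  have a4 := log_integral_sub_integral_log_le_dispersion hY hY1
  rw [integral_add hX hY] at a1 a2
  rw [abs_le]
  have m1 := le_max_left (dispersion P fun ω => X ω + Y ω) (dispersion P Y)
  have m2 := le_max_right (dispersion P fun ω => X ω + Y ω) (dispersion P Y)
  constructor <;> linarith

end Dispersion

/-! ### The received signal of the eavesdropper -/

lemma zE_eq {Ω : Type*} [MeasurableSpace Ω] {P : Measure Ω} {L K M τ : ℕ} [NeZero K]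
    (p : Params L K M τ) (r : Randomness Ω L K M τ) (s : Fin K → ℂ) (n : ℂ) (ω : Ω) :
    zE P p r s n ω =
      gainE P p r 0 ω * s 0 + (∑ t with t ≠ 0, gainE P p r t ω * s t) + n := by
  have h1 : ∑ l, star (hE p r l ω) ⬝ᵥ transmit P p r s l ω = ∑ t, gainE P p r t ω * s t := by
    simp only [transmit, gainE, dotProduct_sum, dotProduct_smul, smul_eq_mul, Finset.sum_mul]
    rw [Finset.sum_comm]
    refine Finset.sum_congr rfl fun t _ => Finset.sum_congr rfl fun l _ => ?_
    ring
  rw [zE, h1, ← Finset.sum_filter_add_sum_filter_not Finset.univ (fun t : Fin K => t = 0)]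
  simp [Finset.filter_eq']

end CellFree

end

theorem proposition2 {Ω : Type*} [MeasurableSpace Ω] (P : Measure Ω) [IsProbabilityMeasure P]
    {L K M τ : ℕ} [NeZero K] (p : CellFree.Params L K M τ) (hp : p.Admissible)
    (r : CellFree.Randomness Ω L K M τ) (hr : r.IsRayleigh P) :
    -- the received signal: desired part, interference, noise
    (∀ (s : Fin K → ℂ) (n : ℂ) (ω : Ω), CellFree.zE P p r s n ω =
      CellFree.gainE P p r 0 ω * s 0 + (∑ t with t ≠ 0, CellFree.gainE P p r t ω * s t) + n) ∧
    -- second moment of the desired gain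
    Integrable (fun ω => ‖CellFree.gainE P p r 0 ω‖ ^ 2) P ∧
    ∫ ω, ‖CellFree.gainE P p r 0 ω‖ ^ 2 ∂P =
      (∑ l, Real.sqrt (p.ρ l 0 * ((M : ℝ) - (p.S l).card) * CellFree.γE p l)) ^ 2
        + ∑ l, p.ρ l 0 * p.βE l
        - ∑ l ∈ CellFree.servedPZF p 0, p.ρ l 0 * CellFree.γE p l ∧
    -- second moments of the interference gains
    (∀ t : Fin K, t ≠ 0 →
      Integrable (fun ω => ‖CellFree.gainE P p r t ω‖ ^ 2) P ∧
      ∫ ω, ‖CellFree.gainE P p r t ω‖ ^ 2 ∂P =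
        ∑ l, p.ρ l t * (p.βE l - CellFree.δ p l 0 * CellFree.γE p l)) ∧
    -- the approximate spectral efficiency in closed form
    CellFree.approxRateE P p r = Real.logb 2 (1 + CellFree.sinrE p) ∧
    -- the spectral efficiency itself, and the error of the approximation
    Integrable (CellFree.instRateE P p r) P ∧
    |CellFree.rateE P p r - Real.logb 2 (1 + CellFree.sinrE p)| ≤
      max (CellFree.dispersion P fun ω => CellFree.signalE P p r ω + CellFree.interfE P p r ω)
        (CellFree.dispersion P (CellFree.interfE P p r)) / Real.log 2 := by
  have hint := CellFree.integrable_norm_sq_gainE hp hr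
  have hnum : ∫ ω, ‖CellFree.gainE P p r 0 ω‖ ^ 2 ∂P = CellFree.sinrENum p := by
    rw [CellFree.integral_norm_sq_gainE hp hr, if_pos rfl, CellFree.sinrENum,
      CellFree.servedPZF, Finset.sum_filter, add_sub_assoc, ← Finset.sum_sub_distrib]
    congr 1
    refine Finset.sum_congr rfl fun l _ => ?_
    unfold CellFree.δ
    split_ifs <;> ring
  have hden : ∀ t : Fin K, t ≠ 0 → ∫ ω, ‖CellFree.gainE P p r t ω‖ ^ 2 ∂P =
      ∑ l, p.ρ l t * (p.βE l - CellFree.δ p l 0 * CellFree.γE p l) := fun t ht => by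
    rw [CellFree.integral_norm_sq_gainE hp hr, if_neg ht, zero_add]
  have happrox : CellFree.approxRateE P p r = Real.logb 2 (1 + CellFree.sinrE p) := by
    rw [CellFree.approxRateE, CellFree.sinrE, hnum,
      Finset.sum_congr rfl fun t ht => hden t (Finset.mem_filter.1 ht).2]
  have hsum : Integrable (fun ω => ∑ t with t ≠ 0, ‖CellFree.gainE P p r t ω‖ ^ 2) P :=
    integrable_finsetSum _ fun t _ => hint t
  have hY : Integrable (CellFree.interfE P p r) P := hsum.add (integrable_const 1)
  have hEY : ∫ ω, CellFree.interfE P p r ω ∂P =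
      ∑ t with t ≠ 0, ∫ ω, ‖CellFree.gainE P p r t ω‖ ^ 2 ∂P + 1 := by
    simp only [CellFree.interfE]
    rw [integral_add hsum (integrable_const 1), integral_finsetSum _ fun t _ => hint t]
    simp
  have hbound := CellFree.abs_integral_log_sub_le (X := CellFree.signalE P p r) (hint 0) hY
    (fun ω => sq_nonneg _)
    (fun ω => le_add_of_nonneg_left (Finset.sum_nonneg fun t _ => sq_nonneg _))
  refine ⟨fun s n ω => CellFree.zE_eq p r s n ω, hint 0, hnum, fun t ht => ⟨hint t, hden t ht⟩,
    happrox, hbound.1, ?_⟩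
  -- Returning from the closed form to the ratio of means puts the claim into the shape of the
  -- general logarithmic bound.
  rw [← happrox, CellFree.approxRateE, ← hEY]
  exact hbound.2
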